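/- Let $K$ be a field, let $n>m\ge 2$ be integers, and let $S=K[x_1,\dots,x_n]$ with its standard $\mathbb Z^n$-grading. Let $$J_{n,m}=(x_i x_{i+1}\cdots x_{i+m-1} : 1\le i\le n)\subset S\qquad(\text{indices modulo } n)$$ be the $m$-path ideal of the cycle graph of length $n$, and put $$\varphi(N,m):=N+1-\left\lfloor\frac{N+1}{m+1}\right\rfloor-\left\lceil\frac{N+1}{m+1}\right\rceil .$$ For a nonzero finitely generated $\mathbb Z^n$-graded $S$-module $M$, a Stanley decomposition of $M$ is a finite direct sum decomposition of $\mathbb{Z}^n$-graded $K$-vector spaces $\mathcal D: M=\bigoplus_{i=1}^r w_iK[Z_i]$, where each $w_i\in M$ is homogeneous, $Z_i\subset\{x_1,\dots,x_n\}$, and $w_iK[Z_i]=\{uw_i: u\in K[Z_i]\}$ is a free $K[Z_i]$-module. Put $\operatorname{sdepth}(\mathcal D)=\min_i|Z_i|$ and let $\operatorname{sdepth}(M)$ be the maximum of $\operatorname{sdepth}(\mathcal D)$ over all Stanley decompositions $\mathcal D$ of $M$. Let $\operatorname{depth}(M)$ be the largest length of an $M$-regular sequence in the ideal $(x_1,\dots,x_n)$.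 Then: 1. $\operatorname{sdepth}(J_{n,m})\ge\min\{\varphi(n-1,m)+m-1,\ \varphi(n,m)+1\}$. 2. $\operatorname{sdepth}(J_{n,m})\ge\operatorname{depth}(J_{n,m})=\varphi(n-1,m)+1$. 3. If $m\ge 3$, then $\operatorname{sdepth}(J_{n,m})\ge\varphi(n,m)+1\ge\operatorname{sdepth}(S/J_{n,m})+1$. -/

import Mathlib

open MvPolynomial

/-- `φ(n, m) = n + 1 - ⌊(n+1)/(m+1)⌋ - ⌈(n+1)/(m+1)⌉`. -/
def pathPhi (n m : ℤ) : ℤ :=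
  n + 1 - ⌊((n : ℚ) + 1) / ((m : ℚ) + 1)⌋ - ⌈((n : ℚ) + 1) / ((m : ℚ) + 1)⌉

/-- The vertex of the `n`-cycle obtained from `i` by `k` steps forward. -/
def cycleStep {n : ℕ} (i : Fin n) (k : ℕ) : Fin n :=
  ⟨(i.val + k) % n, Nat.mod_lt _ i.pos⟩

/-- The `m`-path ideal of the cycle graph of length `n`, generated by the `n` cyclic products
`x_i x_{i+1} ⋯ x_{i+m-1}`, indices modulo `n`. -/
noncomputable def cyclePathIdeal (K : Type*) [Field K] (n m : ℕ) :
    Ideal (MvPolynomial (Fin n) K) :=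
  Ideal.span (Set.range fun i : Fin n =>
    ∏ k ∈ Finset.range m, (X (cycleStep i k) : MvPolynomial (Fin n) K))

section Gradings

variable {K σ : Type*} [Field K] [DecidableEq σ]

/-- The component of degree `a ∈ ℤ^σ` of the polynomial ring, where `x_i` has degree the `i`-th
unit vector. -/
noncomputable def multiDegree (K : Type*) {σ : Type*} [Field K] [DecidableEq σ] (a : σ → ℤ) :
    Submodule K (MvPolynomial σ K) :=
  weightedHomogeneousSubmodule K (fun i : σ => (Pi.single i 1 : σ → ℤ)) a

/-- The `ℤ^σ`-grading that a monomial ideal inherits from the polynomial ring. -/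
noncomputable def idealGrading (J : Ideal (MvPolynomial σ K)) (a : σ → ℤ) : Submodule K J :=
  (multiDegree K a).comap (J.subtype.restrictScalars K)

/-- The `ℤ^σ`-grading that the quotient by a monomial ideal inherits from the polynomial ring. -/
noncomputable def quotientGrading (J : Ideal (MvPolynomial σ K)) (a : σ → ℤ) :
    Submodule K (MvPolynomial σ K ⧸ J) :=
  (multiDegree K a).map (J.mkQ.restrictScalars K)

end Gradings

section Stanley

variable {K σ M : Type*} [Field K] [AddCommGroup M] [Module K M]
  [Module (MvPolynomial σ K) M] [IsScalarTower K (MvPolynomial σ K) M]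

/-- The `K`-subspace `w K[Z] = {u w : u ∈ K[Z]}` of `M`. -/
noncomputable def stanleySpace (K : Type*) {σ M : Type*} [Field K] [AddCommGroup M] [Module K M]
    [Module (MvPolynomial σ K) M] [IsScalarTower K (MvPolynomial σ K) M]
    (w : M) (Z : Finset σ) : Submodule K M :=
  (Subalgebra.toSubmodule (supported K (Z : Set σ))).map
    ((LinearMap.toSpanSingleton (MvPolynomial σ K) M w).restrictScalars K)

/-- A Stanley decomposition `M = ⨁_{i=1}^r w_i K[Z_i]` of a `ℤ^σ`-graded module `M` with graded
components `𝓜 a`: every `w_i` is homogeneous and every `w_i K[Z_i]` is free over `K[Z_i]`. -/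
structure StanleyDecomposition (𝓜 : (σ → ℤ) → Submodule K M) where
  r : ℕ
  w : Fin r → M
  Z : Fin r → Finset σ
  homogeneous : ∀ i, ∃ a, w i ∈ 𝓜 a
  free : ∀ i, ∀ u ∈ supported K (Z i : Set σ), u • w i = 0 → u = 0
  isInternal : DirectSum.IsInternal fun i => stanleySpace K (w i) (Z i)

/-- The Stanley depth `min_i |Z_i|` of a Stanley decomposition (of a nonzero module). -/
noncomputable def StanleyDecomposition.sdepth {𝓜 : (σ → ℤ) → Submodule K M}
    (D : StanleyDecomposition 𝓜) : ℕ :=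
  ⨅ i, (D.Z i).card

/-- The Stanley depth of a (nonzero) `ℤ^σ`-graded module: the largest Stanley depth of its Stanley
decompositions. -/
noncomputable def stanleyDepth (𝓜 : (σ → ℤ) → Submodule K M) : ℕ :=
  sSup (Set.range fun D : StanleyDecomposition 𝓜 => D.sdepth)

end Stanley

/-- The depth of a (graded) module over the polynomial ring: the largest length of an `M`-regular
sequence contained in the ideal generated by the variables. -/
noncomputable def gradedDepth (K σ M : Type*) [Field K] [AddCommGroup M]
    [Module (MvPolynomial σ K) M] : ℕ :=
  sSup {d : ℕ | ∃ rs : List (MvPolynomial σ K), rs.length = d ∧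
    (∀ f ∈ rs, f ∈ Ideal.span (Set.range (X : σ → MvPolynomial σ K))) ∧
    RingTheory.Sequence.IsRegular M rs}

/-! Write c(N) = ⌊N/(m+1)⌋ + ⌈N/(m+1)⌉ (`cycleCodim`) and p(L) = c(L+1) − 1 (`pathCodim`), so that
φ(n−1,m) = n − c(n) and φ(n,m) = n − p(n). As p(n) ≤ c(n), all claims follow from three facts about
the path ideal J: depth J = n − c(n) + 1, sdepth J ≥ n − p(n) + 1 and sdepth S/J ≤ n − p(n).

One recursion drives the first two facts. Consider a path whose first forbidden segment has length s
≤ m, all later ones being the windows of length m. Fixing that segment leaves a shorter path whose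
first segment has length m+1−s. Two such steps restore s, use up m+1 vertices and cost 2, which is
exactly the rule c(N+m+1) = c(N) + 2.

Depth is read off from Koszul cohomology. For the lower bound the generators are added one by one,
with the sequence 0 → S/(I:μ) → S/I → S/(I+(μ)) → 0 (`hasPdLE_cycleGens`). For the upper bound, the
squarefree part of the Koszul complex of S/J is the cochain complex of the vertex sets containing no
window. Stratified by the number of vertices at the end of the labelling, every stratum has
cohomology at most in cardinality n − c(n), and some stratum does have it there, so nothing can
cancel (`not_isAcyclicAt_cycleFaces`).

For sdepth J, a partition into intervals [A,B] of the vertex sets containing a window gives the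
Stanley decomposition with summands x^A K[B]. Sets other than the whole cycle are sorted by the
largest label that starts a run of at least m vertices; the rest of the cycle is then a path treated
by the recursion (`hasIntervalPartition_cycle`). For S/J, any maximal window-free set bounds the
Stanley depth (`stanleyDepth_quotient_le`), and an explicit one has at most n − p(n) elements
(`exists_facet`). -/

/-! ### Koszul cohomology and regular sequences -/

section KoszulComplex

variable {σ R M : Type*} [LinearOrder σ] [CommRing R] [AddCommGroup M] [Module R M]

/-- The sign `(-1)^{#{k ∈ F : k < j}}`. -/
def faceSign (j : σ) (F : Finset σ) : ℤ := (-1) ^ (F.filter (· < j)).card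

lemma faceSign_mul_self (j : σ) (F : Finset σ) : faceSign j F * faceSign j F = 1 := by
  unfold faceSign
  rw [← mul_pow]; simp

lemma faceSign_erase_of_lt {j k : σ} {F : Finset σ} (h : j < k) :
    faceSign j (F.erase k) = faceSign j F := by
  unfold faceSign
  congr 2
  ext x
  simp only [Finset.mem_filter, Finset.mem_erase]
  constructor
  · rintro ⟨⟨_, h2⟩, h3⟩; exact ⟨h2, h3⟩
  · rintro ⟨h2, h3⟩; exact ⟨⟨(h3.trans h).ne, h2⟩, h3⟩

lemma faceSign_erase_of_gt {j k : σ} {F : Finset σ} (hj : j ∈ F) (h : j < k) :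
    faceSign k (F.erase j) = - faceSign k F := by
  unfold faceSign
  rw [Finset.filter_erase]
  have hm : j ∈ F.filter (· < k) := by simp [hj, h]
  rw [← Finset.card_erase_add_one hm, pow_succ]
  ring

lemma faceSign_swap {j k : σ} {F : Finset σ} (hj : j ∈ F) (hk : k ∈ F) (hjk : j ≠ k) :
    faceSign j F * faceSign k (F.erase j) = - (faceSign k F * faceSign j (F.erase k)) := by
  rcases lt_or_gt_of_ne hjk with h | h
  · rw [faceSign_erase_of_gt hj h, faceSign_erase_of_lt h]; ring
  · rw [faceSign_erase_of_gt hk h, faceSign_erase_of_lt h]; ring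

/-- The differential of the Koszul cochain complex of a module with respect to a family `x`;
cochains are functions on the finite subsets of the index set. -/
def koszulD (x : σ → R) (c : Finset σ → M) (F : Finset σ) : M :=
  ∑ j ∈ F, faceSign j F • x j • c (F.erase j)

/-- The terms removing j then k and k then j cancel in pairs, by `faceSign_swap`. -/
lemma koszulD_koszulD (x : σ → R) (c : Finset σ → M) (F : Finset σ) :
    koszulD x (koszulD x c) F = 0 := by
  unfold koszulD
  simp_rw [Finset.smul_sum]
  rw [Finset.sum_sigma']
  refine Finset.sum_involution (fun a _ => ⟨a.2, a.1⟩) ?_ ?_ ?_ ?_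
  · rintro ⟨j, k⟩ h
    simp only [Finset.mem_sigma, Finset.mem_erase] at h
    obtain ⟨hj, hkj, hk⟩ := h
    simp only
    rw [Finset.erase_right_comm (a := k)]
    have := faceSign_swap hj hk hkj.symm
    simp only [smul_comm (x _) (faceSign _ _), smul_smul]
    rw [smul_comm, smul_comm (faceSign k F * _)]
    rw [this, mul_comm (x j)]
    simp only [neg_smul, smul_neg]
    rw [neg_add_eq_zero]
  · rintro ⟨j, k⟩ h _
    simp only [Finset.mem_sigma, Finset.mem_erase] at h
    intro h'
    simp only [Sigma.mk.injEq] at h'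
    exact h.2.1 h'.1
  · rintro ⟨j, k⟩ h
    simp only [Finset.mem_sigma, Finset.mem_erase] at h ⊢
    exact ⟨h.2.2, h.2.1.symm, h.1⟩
  · rintro ⟨j, k⟩ h; rfl

/-- The contraction of a Koszul cochain along an index. -/
def koszulH (v : σ) (c : Finset σ → M) (F : Finset σ) : M :=
  if v ∈ F then 0 else faceSign v (insert v F) • c (insert v F)

/-- Contraction along v is a homotopy between multiplication by x v and zero; hence the ideal
generated by x annihilates Koszul cohomology. -/
lemma koszulD_koszulH_add (x : σ → R) (v : σ) (c : Finset σ → M) (F : Finset σ) :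
    koszulD x (koszulH v c) F + koszulH v (koszulD x c) F = x v • c F := by
  by_cases hv : v ∈ F
  · rw [koszulH, if_pos hv, add_zero, koszulD, Finset.sum_eq_single v]
    · rw [koszulH, if_neg (Finset.notMem_erase v F), Finset.insert_erase hv, smul_comm (x v),
        smul_smul, faceSign_mul_self, one_smul]
    · intro j hj hjv
      rw [koszulH, if_pos (Finset.mem_erase.2 ⟨hjv.symm, hv⟩), smul_zero, smul_zero]
    · intro h; exact absurd hv h
  · rw [koszulH, if_neg hv, koszulD, koszulD, Finset.sum_insert hv, Finset.erase_insert hv,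
      smul_add, smul_smul, faceSign_mul_self, one_smul, add_left_comm, Finset.smul_sum,
      ← Finset.sum_add_distrib, Finset.sum_eq_zero, add_zero]
    intro j hj
    have hjv : j ≠ v := fun h => hv (h ▸ hj)
    rw [koszulH, if_neg (fun h => hv (Finset.mem_of_mem_erase h)),
      ← Finset.erase_insert_of_ne hjv.symm]
    have h1 := faceSign_swap (Finset.mem_insert_of_mem hj) (Finset.mem_insert_self v F) hjv
    rw [Finset.erase_insert hv] at h1
    have h2 : faceSign j F * faceSign v ((insert v F).erase j) =
        - (faceSign v (insert v F) * faceSign j (insert v F)) := by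
      have a := faceSign_mul_self v (insert v F)
      have b := faceSign_mul_self j (insert v F)
      have e := faceSign_mul_self v ((insert v F).erase j)
      have f := faceSign_mul_self j F
      linear_combination (faceSign j (insert v F) * faceSign j F) * h1 -
        (faceSign v ((insert v F).erase j) * faceSign j F) * b -
        (faceSign v (insert v F) * faceSign j (insert v F)) * f
    simp only [smul_comm (x j) (_ : ℤ), smul_smul]
    rw [h2, neg_smul, neg_add_cancel]

/-- Exactness in degree `i` of the Koszul cochain complex with coefficients in `M`. -/
def KoszulExact (x : σ → R) (M : Type*) [AddCommGroup M] [Module R M] (i : ℕ) : Prop :=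
  ∀ c : Finset σ → M, (∀ F, F.card = i + 1 → koszulD x c F = 0) →
    ∃ e : Finset σ → M, ∀ F, F.card = i → c F = koszulD x e F

variable {N P : Type*} [AddCommGroup N] [Module R N] [AddCommGroup P] [Module R P]

lemma koszulD_map (x : σ → R) (f : M →ₗ[R] N) (c : Finset σ → M) (F : Finset σ) :
    koszulD x (fun G => f (c G)) F = f (koszulD x c F) := by
  simp [koszulD, map_sum]

lemma koszulD_sub (x : σ → R) (c e : Finset σ → M) (F : Finset σ) :
    koszulD x (fun G => c G - e G) F = koszulD x c F - koszulD x e F := by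
  simp [koszulD, smul_sub, Finset.sum_sub_distrib]

lemma koszulD_add (x : σ → R) (c e : Finset σ → M) (F : Finset σ) :
    koszulD x (fun G => c G + e G) F = koszulD x c F + koszulD x e F := by
  simp [koszulD, smul_add, Finset.sum_add_distrib]

lemma koszulD_smul (x : σ → R) (r : R) (c : Finset σ → M) (F : Finset σ) :
    koszulD x (fun G => r • c G) F = r • koszulD x c F := by
  simp only [koszulD, Finset.smul_sum]
  refine Finset.sum_congr rfl fun j _ => ?_
  rw [smul_comm r, smul_comm r (x j)]

lemma koszulD_congr {x : σ → R} {c e : Finset σ → M} {F : Finset σ}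
    (h : ∀ G, G.card + 1 = F.card → c G = e G) : koszulD x c F = koszulD x e F := by
  refine Finset.sum_congr rfl fun j hj => ?_
  rw [h _ (Finset.card_erase_add_one hj)]

/-- A cocycle multiplied by an element of the ideal generated by `x` is a coboundary. -/
lemma exists_smul_eq_koszulD {x : σ → R} {f : R} (hf : f ∈ Ideal.span (Set.range x)) {i : ℕ}
    {c : Finset σ → M} (hc : ∀ F, F.card = i + 1 → koszulD x c F = 0) :
    ∃ e : Finset σ → M, ∀ F, F.card = i → f • c F = koszulD x e F := by
  induction hf using Submodule.span_induction with
  | mem f h =>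
    obtain ⟨v, rfl⟩ := h
    refine ⟨koszulH v c, fun F hF => ?_⟩
    rw [← koszulD_koszulH_add, add_eq_left, koszulH]
    split_ifs with hv
    · rfl
    · rw [hc _ (by rw [Finset.card_insert_of_notMem hv, hF]), smul_zero]
  | zero => exact ⟨fun _ => 0, fun F _ => by simp [koszulD]⟩
  | add f g _ _ h1 h2 =>
    obtain ⟨e1, h1⟩ := h1
    obtain ⟨e2, h2⟩ := h2
    exact ⟨fun G => e1 G + e2 G, fun F hF => by rw [add_smul, h1 F hF, h2 F hF, koszulD_add]⟩
  | smul r f _ h =>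
    obtain ⟨e, h⟩ := h
    exact ⟨fun G => r • e G, fun F hF => by
      rw [smul_eq_mul, mul_smul, h F hF, koszulD_smul]⟩

section ShortExact

variable {x : σ → R} {f : M →ₗ[R] N} {g : N →ₗ[R] P}

/-- Part of the long exact cohomology sequence of 0 → M → N → P → 0, chased by hand: lift a cocycle
to N, and correct the lift by a cochain of M bounding its differential. `KoszulExact.left` is the
companion statement for M. -/
lemma KoszulExact.right (hf : Function.Injective f) (hg : Function.Surjective g)
    (hfg : ∀ y, g y = 0 → ∃ z, f z = y) (hgf : ∀ z, g (f z) = 0) {i : ℕ}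
    (hN : KoszulExact x N i) (hM : KoszulExact x M (i + 1)) : KoszulExact x P i := by
  intro c hc
  choose l hl using hg
  have h1 : ∀ F : Finset σ, ∃ z, F.card = i + 1 → f z = koszulD x (fun G => l (c G)) F := by
    intro F
    by_cases hF : F.card = i + 1
    · obtain ⟨z, hz⟩ := hfg (koszulD x (fun G => l (c G)) F) (by
        rw [← koszulD_map]; simp only [hl]; exact hc F hF)
      exact ⟨z, fun _ => hz⟩
    · exact ⟨0, fun h => absurd h hF⟩
  choose z hz using h1
  obtain ⟨y, hy⟩ := hM z (fun F hF => hf (by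
    rw [← koszulD_map, map_zero, koszulD_congr (e := koszulD x (fun G => l (c G))),
      koszulD_koszulD]
    intro G hG
    exact hz G (by omega)))
  obtain ⟨u, hu⟩ := hN (fun G => l (c G) - f (y G)) (fun F hF => by
    rw [koszulD_sub, koszulD_map, ← hz F hF, hy F hF, sub_self])
  refine ⟨fun G => g (u G), fun F hF => ?_⟩
  rw [koszulD_map, ← hu F hF, map_sub, hl, hgf, sub_zero]

lemma KoszulExact.left (hf : Function.Injective f) (hg : Function.Surjective g)
    (hfg : ∀ y, g y = 0 → ∃ z, f z = y) (hgf : ∀ z, g (f z) = 0) {i : ℕ}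
    (hN : KoszulExact x N (i + 1)) (hP : KoszulExact x P i) : KoszulExact x M (i + 1) := by
  intro c hc
  obtain ⟨e, he⟩ := hN (fun G => f (c G)) (fun F hF => by rw [koszulD_map, hc F hF, map_zero])
  obtain ⟨b, hb⟩ := hP (fun G => g (e G)) (fun F hF => by rw [koszulD_map, ← he F hF, hgf])
  choose l hl using hg
  have h1 : ∀ F : Finset σ, ∃ z, F.card = i → f z = e F - koszulD x (fun G => l (b G)) F := by
    intro F
    by_cases hF : F.card = i
    · obtain ⟨z, hz⟩ := hfg (e F - koszulD x (fun G => l (b G)) F) (by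
        rw [map_sub, ← koszulD_map]; simp only [hl]; rw [hb F hF, sub_self])
      exact ⟨z, fun _ => hz⟩
    · exact ⟨0, fun h => absurd h hF⟩
  choose z hz using h1
  refine ⟨z, fun F hF => hf ?_⟩
  rw [← koszulD_map, he F hF,
    koszulD_congr (c := fun G => f (z G)) (e := fun G => e G - koszulD x (fun G => l (b G)) G),
    koszulD_sub, koszulD_koszulD, sub_zero]
  intro G hG
  exact hz G (by omega)

lemma KoszulExact.of_injective (hf : Function.Injective f) (hN : KoszulExact x N 0) :
    KoszulExact x M 0 := by
  intro c hc
  obtain ⟨e, he⟩ := hN (fun G => f (c G)) (fun F hF => by rw [koszulD_map, hc F hF, map_zero])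
  refine ⟨fun _ => 0, fun F hF => hf ?_⟩
  rw [he F hF, Finset.card_eq_zero.1 hF]
  simp [koszulD]

end ShortExact

section Regular

open RingTheory.Sequence Pointwise

lemma mem_quotSMulTop_mk_eq_zero {r : R} {y : M}
    (h : (Submodule.mkQ (r • (⊤ : Submodule R M))) y = 0) : ∃ z, r • z = y := by
  rw [Submodule.mkQ_apply, Submodule.Quotient.mk_eq_zero] at h
  obtain ⟨z, -, hz⟩ := (Submodule.mem_smul_pointwise_iff_exists _ _ _).1 h
  exact ⟨z, hz⟩

/-- Induction on the sequence. For a cocycle c, r • c = dw because r annihilates cohomology. Then w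
is a cocycle modulo r, so w = dv + r • z by induction, and r • c = r • dz; cancel r. -/
lemma KoszulExact.of_isWeaklyRegular {x : σ → R} (rs : List R) :
    ∀ {M : Type*} [AddCommGroup M] [Module R M],
    (∀ f ∈ rs, f ∈ Ideal.span (Set.range x)) → IsWeaklyRegular M rs →
    ∀ i < rs.length, KoszulExact x M i := by
  induction rs with
  | nil => intro M _ _ _ _ i hi; simp at hi
  | cons r rs ih =>
    intro M _ _ hrs hreg i hi
    rw [isWeaklyRegular_cons_iff] at hreg
    have ih' := ih (fun f hf => hrs f (List.mem_cons_of_mem _ hf)) hreg.2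
    intro c hc
    obtain ⟨w, hw⟩ := exists_smul_eq_koszulD (hrs r List.mem_cons_self) hc
    let π := Submodule.mkQ (r • (⊤ : Submodule R M))
    have hπ : ∀ z, π (r • z) = 0 := fun z => by
      rw [Submodule.mkQ_apply, Submodule.Quotient.mk_eq_zero]
      exact Submodule.smul_mem_pointwise_smul _ _ _ trivial
    cases i with
    | zero =>
      refine ⟨fun _ => 0, fun F hF => ?_⟩
      have := hw F hF
      rw [Finset.card_eq_zero.1 hF] at this ⊢
      simp only [koszulD, Finset.sum_empty] at this ⊢
      exact hreg.1 (by simpa using this)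
    | succ i =>
      obtain ⟨v, hv⟩ := ih' i (by simpa using hi) (fun G => π (w G)) (fun F hF => by
        rw [koszulD_map, ← hw F hF, hπ])
      choose l hl using Submodule.mkQ_surjective (r • (⊤ : Submodule R M))
      have h1 : ∀ F : Finset σ, ∃ z,
          F.card = i → r • z = w F - koszulD x (fun G => l (v G)) F := by
        intro F
        by_cases hF : F.card = i
        · obtain ⟨z, hz⟩ := mem_quotSMulTop_mk_eq_zero
            (y := w F - koszulD x (fun G => l (v G)) F) (by
              rw [map_sub, ← koszulD_map, funext fun G => hl (v G)]
              exact sub_eq_zero.2 (hv F hF))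
          exact ⟨z, fun _ => hz⟩
        · exact ⟨0, fun h => absurd h hF⟩
      choose z hz using h1
      refine ⟨z, fun F hF => hreg.1 ?_⟩
      simp only
      rw [hw F hF, ← koszulD_smul, koszulD_congr (c := fun G => r • z G)
        (e := fun G => w G - koszulD x (fun G => l (v G)) G), koszulD_sub, koszulD_koszulD,
        sub_zero]
      intro G hG
      exact hz G (by omega)

lemma KoszulExact.quotSMulTop {x : σ → R} {r : R} (hr : IsSMulRegular M r) {i : ℕ}
    (h0 : KoszulExact x M i) (h1 : KoszulExact x M (i + 1)) :
    KoszulExact x (QuotSMulTop r M) i :=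
  KoszulExact.right (f := LinearMap.lsmul R M r)
    (g := Submodule.mkQ (r • (⊤ : Submodule R M))) hr (Submodule.mkQ_surjective _)
    (fun y hy => mem_quotSMulTop_mk_eq_zero hy)
    (fun z => by
      rw [Submodule.mkQ_apply, Submodule.Quotient.mk_eq_zero]
      exact Submodule.smul_mem_pointwise_smul _ _ _ trivial) h0 h1

/-- Exactness in degree 0 says that no nonzero element of M is killed by all x j, that is,
Hom(R/(x), M) = 0; over a Noetherian ring this yields a regular element in (x). -/
lemma KoszulExact.exists_isSMulRegular [IsNoetherianRing R] [Module.Finite R M] {x : σ → R}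
    (h : KoszulExact x M 0) : ∃ r ∈ Ideal.span (Set.range x), IsSMulRegular M r := by
  have hs : Subsingleton ((R ⧸ Ideal.span (Set.range x)) →ₗ[R] M) := by
    refine subsingleton_of_forall_eq 0 fun f => ?_
    obtain ⟨e, he⟩ := h (fun _ => f 1) (fun F _ => by
      refine Finset.sum_eq_zero fun j _ => ?_
      have h1 : x j • (1 : R ⧸ Ideal.span (Set.range x)) = 0 := by
        rw [Algebra.smul_def, mul_one, Ideal.Quotient.algebraMap_eq]
        exact Ideal.Quotient.eq_zero_iff_mem.2 (Ideal.subset_span ⟨j, rfl⟩)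
      rw [← map_smul, h1, map_zero, smul_zero])
    have h1 : f 1 = 0 := by simpa [koszulD] using he ∅ rfl
    ext
    simpa using h1
  obtain ⟨r, hr, h'⟩ := IsSMulRegular.subsingleton_linearMap_iff.1 hs
  rw [Ideal.annihilator_quotient] at hr
  exact ⟨r, hr, h'⟩

/-- Dividing by a regular element costs exactly one degree of exactness, so the previous step can be
repeated d times. -/
lemma exists_isWeaklyRegular_of_koszulExact [IsNoetherianRing R] {x : σ → R} (d : ℕ) :
    ∀ {M : Type*} [AddCommGroup M] [Module R M] [Module.Finite R M],
    (∀ i < d, KoszulExact x M i) → ∃ rs : List R, rs.length = d ∧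
      (∀ f ∈ rs, f ∈ Ideal.span (Set.range x)) ∧ IsWeaklyRegular M rs := by
  induction d with
  | zero => intro M _ _ _ _; exact ⟨[], rfl, by simp, IsWeaklyRegular.nil R M⟩
  | succ d ih =>
    intro M _ _ _ h
    obtain ⟨r, hr, hreg⟩ := (h 0 d.succ_pos).exists_isSMulRegular
    obtain ⟨rs, h1, h2, h3⟩ := ih (M := QuotSMulTop r M) (fun i hi =>
      (h i (by omega)).quotSMulTop hreg (h (i + 1) (by omega)))
    refine ⟨r :: rs, by simp [h1], ?_, IsWeaklyRegular.cons hreg h3⟩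
    intro f hf
    rcases List.mem_cons.1 hf with rfl | hf
    · exact hr
    · exact h2 f hf

end Regular

end KoszulComplex

/-! ### Squarefree monomial ideals as upward closed families of supports -/

section SquarefreeIdeals

variable {σ : Type*} {K : Type*} [Field K]

/-- The monomial ideal spanned by the monomials whose support has the property `U`. -/
noncomputable def sqfreeIdeal (K : Type*) {σ : Type*} [Field K] (U : Finset σ → Prop) :
    Ideal (MvPolynomial σ K) :=
  Ideal.span ((fun s => monomial s (1 : K)) '' {s : σ →₀ ℕ | U s.support})

/-- Upward closed properties of finite sets. -/
def IsUpClosed (U : Finset σ → Prop) : Prop := ∀ ⦃S T : Finset σ⦄, S ⊆ T → U S → U T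

lemma mem_sqfreeIdeal {U : Finset σ → Prop} (hU : IsUpClosed U) {p : MvPolynomial σ K} :
    p ∈ sqfreeIdeal K U ↔ ∀ u, coeff u p ≠ 0 → U u.support := by
  rw [sqfreeIdeal, mem_ideal_span_monomial_image]
  refine forall_congr' fun u => ?_
  rw [mem_support_iff]
  refine imp_congr_right fun _ => ⟨?_, fun h => ⟨u, h, le_rfl⟩⟩
  rintro ⟨s, hs, hsu⟩
  exact hU (Finsupp.support_mono hsu) hs

lemma monomial_mem_sqfreeIdeal {U : Finset σ → Prop} {s : σ →₀ ℕ} (h : U s.support) :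
    monomial s (1 : K) ∈ sqfreeIdeal K U :=
  Ideal.subset_span ⟨s, h, rfl⟩

variable [DecidableEq σ]

/-- The exponent vector of the squarefree monomial with support `w`. -/
noncomputable def sqfreeExp (w : Finset σ) : σ →₀ ℕ := Finsupp.indicator w fun _ _ => 1

lemma sqfreeExp_apply (w : Finset σ) (i : σ) : sqfreeExp w i = if i ∈ w then 1 else 0 := by
  simp [sqfreeExp, Finsupp.indicator_apply]

lemma support_sqfreeExp (w : Finset σ) : (sqfreeExp w).support = w := by
  ext i; simp [sqfreeExp_apply]

lemma sqfreeExp_le {w : Finset σ} {s : σ →₀ ℕ} : sqfreeExp w ≤ s ↔ w ⊆ s.support := by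
  constructor
  · intro h i hi
    have := h i
    rw [sqfreeExp_apply, if_pos hi] at this
    rw [Finsupp.mem_support_iff]; omega
  · intro h i
    rw [sqfreeExp_apply]
    split_ifs with hi
    · have := Finsupp.mem_support_iff.1 (h hi)
      omega
    · exact Nat.zero_le _

lemma sqfreeExp_erase {F : Finset σ} {j : σ} (hj : j ∈ F) :
    sqfreeExp F = Finsupp.single j 1 + sqfreeExp (F.erase j) := by
  ext k
  rw [Finsupp.add_apply, sqfreeExp_apply, sqfreeExp_apply, Finsupp.single_apply]
  by_cases hk : j = k
  · subst hk; simp [hj]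
  · simp [hk, Ne.symm hk]

lemma monomial_sqfreeExp (F : Finset σ) :
    monomial (sqfreeExp F) (1 : K) = ∏ j ∈ F, X j := by
  induction F using Finset.induction_on with
  | empty =>
    have h : sqfreeExp (∅ : Finset σ) = 0 := by ext i; simp [sqfreeExp_apply]
    simp [h]
  | insert j F hj ih =>
    rw [sqfreeExp_erase (Finset.mem_insert_self j F), Finset.erase_insert hj,
      Finset.prod_insert hj, ← ih, X, monomial_mul, one_mul]

lemma support_add_eq_union (s t : σ →₀ ℕ) : (s + t).support = s.support ∪ t.support := by
  ext i; simp only [Finsupp.mem_support_iff, Finsupp.add_apply, Finset.mem_union]; omega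

/-- The colon ideal by a squarefree monomial: multiplication by x^w replaces each support T by T ∪
w. -/
lemma monomial_mul_mem_sqfreeIdeal {U : Finset σ → Prop} (hU : IsUpClosed U) (w : Finset σ)
    {p : MvPolynomial σ K} :
    monomial (sqfreeExp w) 1 * p ∈ sqfreeIdeal K U ↔
      p ∈ sqfreeIdeal K (fun T => U (T ∪ w)) := by
  rw [mem_sqfreeIdeal hU, mem_sqfreeIdeal (fun S T h => hU (Finset.union_subset_union_left h))]
  constructor
  · intro h u hu
    have := h (sqfreeExp w + u) (by rwa [coeff_monomial_mul, one_mul])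
    rwa [support_add_eq_union, support_sqfreeExp, Finset.union_comm] at this
  · intro h u hu
    rw [coeff_monomial_mul'] at hu
    split_ifs at hu with hw
    · rw [one_mul] at hu
      have := h _ hu
      have h2 := support_add_eq_union (u - sqfreeExp w) (sqfreeExp w)
      rw [tsub_add_cancel_of_le hw, support_sqfreeExp] at h2
      rwa [h2]
    · exact absurd rfl hu

lemma sqfreeIdeal_or (U : Finset σ → Prop) (w : Finset σ) :
    sqfreeIdeal K (fun T => U T ∨ w ⊆ T) =
      sqfreeIdeal K U ⊔ Ideal.span {monomial (sqfreeExp w) (1 : K)} := by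
  apply le_antisymm
  · rw [sqfreeIdeal, Ideal.span_le]
    rintro _ ⟨s, h | h, rfl⟩
    · exact Ideal.mem_sup_left (monomial_mem_sqfreeIdeal h)
    · refine Ideal.mem_sup_right (Ideal.mem_span_singleton.2 ?_)
      exact monomial_dvd_monomial.2 ⟨Or.inr (sqfreeExp_le.2 h), dvd_rfl⟩
  · refine sup_le (Ideal.span_mono (Set.image_mono fun s h => Or.inl h)) ?_
    rw [Ideal.span_le, Set.singleton_subset_iff]
    exact monomial_mem_sqfreeIdeal (Or.inr (by rw [support_sqfreeExp]))

end SquarefreeIdeals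

/-- The sequence `0 → R / (I : μ) → R / I → R / (I + (μ)) → 0` in Koszul cohomology. -/
lemma KoszulExact.quotient_sup_span {σ R : Type*} [LinearOrder σ] [CommRing R] {x : σ → R}
    {I A J : Ideal R} {μ : R} (hA : ∀ p, μ * p ∈ I ↔ p ∈ A) (hJ : J = I ⊔ Ideal.span {μ}) {i : ℕ}
    (h0 : KoszulExact x (R ⧸ I) i) (h1 : KoszulExact x (R ⧸ A) (i + 1)) :
    KoszulExact x (R ⧸ J) i := by
  have hle : I ≤ J := hJ ▸ le_sup_left
  obtain ⟨f, hf⟩ : ∃ f : (R ⧸ A) →ₗ[R] (R ⧸ I),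
      ∀ p, f (Submodule.Quotient.mk p) = Submodule.Quotient.mk (μ * p) :=
    ⟨Submodule.mapQ A I (LinearMap.mulLeft R μ) (fun p hp => (hA p).2 hp), fun p => rfl⟩
  obtain ⟨g, hg⟩ : ∃ g : (R ⧸ I) →ₗ[R] (R ⧸ J),
      ∀ p, g (Submodule.Quotient.mk p) = Submodule.Quotient.mk p :=
    ⟨Submodule.mapQ I J LinearMap.id (fun p hp => hle hp), fun p => rfl⟩
  refine KoszulExact.right (f := f) (g := g) ?_ ?_ ?_ ?_ h0 h1
  · rw [← LinearMap.ker_eq_bot, LinearMap.ker_eq_bot']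
    intro y hy
    obtain ⟨y, rfl⟩ := Submodule.Quotient.mk_surjective _ y
    rw [hf, Submodule.Quotient.mk_eq_zero] at hy
    rw [Submodule.Quotient.mk_eq_zero]
    exact (hA y).1 hy
  · intro y
    obtain ⟨y, rfl⟩ := Submodule.Quotient.mk_surjective _ y
    exact ⟨_, hg y⟩
  · intro y hy
    obtain ⟨y, rfl⟩ := Submodule.Quotient.mk_surjective _ y
    rw [hg, Submodule.Quotient.mk_eq_zero, hJ] at hy
    obtain ⟨a, ha, b, hb, rfl⟩ := Submodule.mem_sup.1 hy
    obtain ⟨c, rfl⟩ := Ideal.mem_span_singleton'.1 hb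
    refine ⟨Submodule.Quotient.mk c, ?_⟩
    rw [hf, eq_comm, Submodule.Quotient.eq, mul_comm c, add_sub_cancel_right]
    exact ha
  · intro z
    obtain ⟨z, rfl⟩ := Submodule.Quotient.mk_surjective _ z
    rw [hf, hg, Submodule.Quotient.mk_eq_zero, hJ]
    exact Ideal.mem_sup_right (Ideal.mul_mem_right _ _ (Ideal.mem_span_singleton_self _))

/-! ### Bounding projective dimension by adding generators -/

section ProjectiveDimension

variable {K : Type*} [Field K] {n : ℕ}

open RingTheory.Sequence in
lemma isWeaklyRegular_variables (K : Type*) [Field K] (n : ℕ) :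
    IsWeaklyRegular (MvPolynomial (Fin n) K)
      ((List.finRange n).map (X : Fin n → MvPolynomial (Fin n) K)) := by
  refine ⟨fun i hi => ?_⟩
  have hi' : i < n := by simpa using hi
  -- The first i variables generate a monomial ideal, modulo which the next variable is visibly a
  -- nonzerodivisor.
  have hI : Ideal.ofList (((List.finRange n).map (X : Fin n → MvPolynomial (Fin n) K)).take i) =
      Ideal.span (X '' {j : Fin n | j.val < i}) := by
    rw [Ideal.ofList]
    congr 1
    ext p
    rw [← List.map_take]
    simp only [List.mem_map, Set.mem_ofPred_eq, Set.mem_image]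
    refine exists_congr fun j => and_congr_left fun _ => ?_
    rw [List.mem_take_iff_getElem]
    constructor
    · rintro ⟨k, hk, rfl⟩
      simp at hk ⊢; omega
    · intro h
      exact ⟨j.val, by simp; omega, by simp⟩
  rw [hI, smul_eq_mul, Ideal.mul_top, isSMulRegular_quotient_iff_mem_of_smul_mem]
  intro p hp
  rw [mem_ideal_span_X_image] at hp ⊢
  intro u hu
  simp only [List.getElem_map, List.getElem_finRange, smul_eq_mul] at hp
  obtain ⟨j, hj, hne⟩ := hp (Finsupp.single ⟨i, hi'⟩ 1 + u) (by
    rw [mem_support_iff]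
    change coeff _ (monomial (Finsupp.single (⟨i, hi'⟩ : Fin n) 1) 1 * p) ≠ 0
    rw [coeff_monomial_mul, one_mul]
    exact mem_support_iff.1 hu)
  refine ⟨j, hj, ?_⟩
  have hji : (⟨i, hi'⟩ : Fin n) ≠ j := by
    rintro rfl
    simp at hj
  rwa [Finsupp.add_apply, Finsupp.single_eq_of_ne hji.symm, zero_add] at hne

lemma koszulExact_polynomial {i : ℕ} (hi : i < n) :
    KoszulExact (X : Fin n → MvPolynomial (Fin n) K) (MvPolynomial (Fin n) K) i := by
  refine KoszulExact.of_isWeaklyRegular _ ?_ (isWeaklyRegular_variables K n) i (by simpa using hi)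
  intro f hf
  obtain ⟨j, -, rfl⟩ := List.mem_map.1 hf
  exact Ideal.subset_span ⟨j, rfl⟩

/-- The Koszul cohomology of `S / I_U` vanishes below degree `n - p`; that is, `S / I_U` has
projective dimension at most `p`. -/
def HasPdLE (K : Type*) [Field K] {n : ℕ} (U : Finset (Fin n) → Prop) (p : ℕ) : Prop :=
  ∀ i, i + p < n → KoszulExact (X : Fin n → MvPolynomial (Fin n) K)
    (MvPolynomial (Fin n) K ⧸ sqfreeIdeal K U) i

lemma HasPdLE.mono {U : Finset (Fin n) → Prop} {p q : ℕ} (h : HasPdLE K U p) (hpq : p ≤ q) :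
    HasPdLE K U q := fun i hi => h i (by omega)

lemma HasPdLE.congr {U V : Finset (Fin n) → Prop} {p : ℕ} (h : HasPdLE K U p)
    (hUV : ∀ T, V T ↔ U T) : HasPdLE K V p := by
  obtain rfl : V = U := funext fun T => propext (hUV T)
  exact h

lemma HasPdLE.of_false {U : Finset (Fin n) → Prop} (hU : ∀ T, ¬ U T) (p : ℕ) :
    HasPdLE K U p := by
  intro i hi
  have hbot : sqfreeIdeal K U = ⊥ := by
    rw [sqfreeIdeal, Ideal.span_eq_bot]
    rintro _ ⟨s, hs, rfl⟩
    exact absurd hs (hU _)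
  let e := (Submodule.quotEquivOfEqBot _ hbot)
  have h1 : i < n := by omega
  intro c hc
  obtain ⟨y, hy⟩ := koszulExact_polynomial (K := K) h1 (fun F => e (c F)) (fun F hF => by
    rw [← LinearEquiv.coe_coe, koszulD_map, hc F hF, map_zero])
  refine ⟨fun F => e.symm (y F), fun F hF => ?_⟩
  rw [← LinearEquiv.coe_coe, koszulD_map, ← hy F hF, LinearEquiv.coe_coe,
    LinearEquiv.symm_apply_apply]

/-- With μ = x^w, the quotient S/(I + (μ)) is resolved by a mapping cone over S/I and S/(I:μ); the
colon ideal enters shifted by one degree. -/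
lemma HasPdLE.or {U : Finset (Fin n) → Prop} (hU : IsUpClosed U) (w : Finset (Fin n))
    {p q : ℕ} (h : HasPdLE K U p) (hq : HasPdLE K (fun T => U (T ∪ w)) q) (hp : p ≤ q + 1) :
    HasPdLE K (fun T => U T ∨ w ⊆ T) (q + 1) := by
  intro i hi
  exact KoszulExact.quotient_sup_span (fun p => monomial_mul_mem_sqfreeIdeal hU w)
    (sqfreeIdeal_or U w) (h i (by omega)) (hq (i + 1) (by omega))

end ProjectiveDimension

/-! ### Arithmetic of the two counting functions -/

section Counting

/-- `⌊N/(m+1)⌋ + ⌈N/(m+1)⌉`. -/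
def cycleCodim (m N : ℕ) : ℕ := N / (m + 1) + (N + m) / (m + 1)

/-- `⌊(L+1)/(m+1)⌋ + ⌈(L+1)/(m+1)⌉ - 1`. -/
def pathCodim (m L : ℕ) : ℕ := L / (m + 1) + (L + 1) / (m + 1)

variable {m : ℕ}

lemma cycleCodim_succ (L : ℕ) : cycleCodim m (L + 1) = pathCodim m L + 1 := by
  have : (L + 1 + m) / (m + 1) = L / (m + 1) + 1 := by
    rw [add_assoc, add_comm 1 m, Nat.add_div_right _ m.succ_pos]
  rw [cycleCodim, pathCodim, this]; ring

lemma cycleCodim_add (N : ℕ) : cycleCodim m (N + (m + 1)) = cycleCodim m N + 2 := by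
  have : (N + (m + 1) + m) / (m + 1) = (N + m) / (m + 1) + 1 := by
    rw [add_right_comm, Nat.add_div_right _ m.succ_pos]
  rw [cycleCodim, cycleCodim, this, Nat.add_div_right _ m.succ_pos]; ring

lemma pathCodim_add (L : ℕ) : pathCodim m (L + (m + 1)) = pathCodim m L + 2 := by
  have h1 := cycleCodim_succ (m := m) (L + (m + 1))
  have h2 := cycleCodim_succ (m := m) L
  have h3 := cycleCodim_add (m := m) (L + 1)
  rw [add_right_comm] at h3
  omega

lemma cycleCodim_mono {M N : ℕ} (h : M ≤ N) : cycleCodim m M ≤ cycleCodim m N :=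
  add_le_add (Nat.div_le_div_right h) (Nat.div_le_div_right (by omega))

lemma pathCodim_mono {M N : ℕ} (h : M ≤ N) : pathCodim m M ≤ pathCodim m N :=
  add_le_add (Nat.div_le_div_right h) (Nat.div_le_div_right (by omega))

lemma cycleCodim_pos {N : ℕ} (h : 1 ≤ N) : 1 ≤ cycleCodim m N := by
  obtain ⟨L, rfl⟩ : ∃ L, N = L + 1 := ⟨N - 1, by omega⟩
  rw [cycleCodim_succ]; omega

lemma pathCodim_self : pathCodim m m = 1 := by
  rw [pathCodim, Nat.div_self m.succ_pos, Nat.div_eq_of_lt (by omega)]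

lemma pathCodim_le_cycleCodim (hm : 1 ≤ m) (L : ℕ) : pathCodim m L ≤ cycleCodim m L :=
  add_le_add le_rfl (Nat.div_le_div_right (by omega))

end Counting

/-! ### Windows of the path and their colon ideals -/

section Windows

variable {n : ℕ}

/-- `T` contains all vertices `v` with `i ≤ v < l`. -/
def HasRun (T : Finset (Fin n)) (i l : ℕ) : Prop := ∀ v : Fin n, i ≤ v.val → v.val < l → v ∈ T

/-- `T` contains the initial segment of length `s` of the path on the vertices `b ≤ v < N`, or `m`
consecutive vertices of this path other than `b`. -/
def PathGens (m b s N : ℕ) (T : Finset (Fin n)) : Prop :=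
  (b + s ≤ N ∧ HasRun T b (b + s)) ∨ ∃ j, b + 1 ≤ j ∧ j + m ≤ N ∧ HasRun T j (j + m)

/-- `T` contains `m` cyclically consecutive vertices starting with one of the first `a`. -/
def CycleGens (m a : ℕ) (T : Finset (Fin n)) : Prop :=
  ∃ j < a, HasRun T j (j + m) ∧ HasRun T 0 (j + m - n)

lemma HasRun.mono {S T : Finset (Fin n)} (h : S ⊆ T) {i l : ℕ} (hS : HasRun S i l) :
    HasRun T i l := fun v h1 h2 => h (hS v h1 h2)

lemma HasRun.sub {T : Finset (Fin n)} {i l i' l' : ℕ} (h : HasRun T i l) (hi : i ≤ i')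
    (hl : l' ≤ l) : HasRun T i' l' := fun v h1 h2 => h v (by omega) (by omega)

lemma isUpClosed_pathGens (m b s N : ℕ) : IsUpClosed (PathGens (n := n) m b s N) := by
  rintro S T h (⟨h1, h2⟩ | ⟨j, h1, h2, h3⟩)
  · exact Or.inl ⟨h1, h2.mono h⟩
  · exact Or.inr ⟨j, h1, h2, h3.mono h⟩

lemma isUpClosed_cycleGens (m a : ℕ) : IsUpClosed (CycleGens (n := n) m a) := by
  rintro S T h ⟨j, h1, h2, h3⟩
  exact ⟨j, h1, h2.mono h, h3.mono h⟩

lemma not_pathGens {m b s N : ℕ} (hs : s ≤ m) (h : N < b + s) (T : Finset (Fin n)) :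
    ¬ PathGens m b s N T := by
  rintro (⟨h1, -⟩ | ⟨j, h1, h2, -⟩) <;> omega

/-- The vertices `v` with `i ≤ v < l`. -/
def vertexSegment (n i l : ℕ) : Finset (Fin n) := Finset.univ.filter fun v => i ≤ v.val ∧ v.val < l

lemma mem_vertexSegment {i l : ℕ} {v : Fin n} : v ∈ vertexSegment n i l ↔ i ≤ v.val ∧ v.val < l := by
  simp [vertexSegment]

lemma vertexSegment_subset {T : Finset (Fin n)} {i l : ℕ} : vertexSegment n i l ⊆ T ↔ HasRun T i l := by
  constructor
  · intro h v h1 h2; exact h (mem_vertexSegment.2 ⟨h1, h2⟩)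
  · intro h v hv; exact h v (mem_vertexSegment.1 hv).1 (mem_vertexSegment.1 hv).2

/-- Singles out the initial segment as the last generator to be added: the others are all the
m-windows of the path with b deleted. -/
lemma pathGens_iff {m b s N : ℕ} (hsN : b + s ≤ N) (T : Finset (Fin n)) :
    PathGens m b s N T ↔ PathGens m (b + 1) m N T ∨ vertexSegment n b (b + s) ⊆ T := by
  rw [vertexSegment_subset, PathGens, PathGens]
  constructor
  · rintro (⟨-, h⟩ | ⟨j, h1, h2, h3⟩)
    · exact Or.inr h
    · rcases h1.eq_or_lt with rfl | h1
      · exact Or.inl (Or.inl ⟨h2, h3⟩)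
      · exact Or.inl (Or.inr ⟨j, h1, h2, h3⟩)
  · rintro ((⟨h1, h2⟩ | ⟨j, h1, h2, h3⟩) | h)
    · exact Or.inr ⟨b + 1, le_rfl, h1, h2⟩
    · exact Or.inr ⟨j, by omega, h2, h3⟩
    · exact Or.inl ⟨hsN, h⟩

/-- Once [b, b+s) is present, the window at b+1 only requires [b+s, b+1+m), of length m+1−s. Windows
starting in (b+1, b+s] require more and become redundant. -/
lemma pathGens_union_vertexSegment {m b s N : ℕ} (hs : 1 ≤ s) (hsm : s ≤ m) (T : Finset (Fin n)) :
    PathGens m (b + 1) m N (T ∪ vertexSegment n b (b + s)) ↔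
      PathGens m (b + s) (m + 1 - s) N T := by
  constructor
  · intro h
    obtain ⟨j, h1, h2, h3⟩ : ∃ j, b + 1 ≤ j ∧ j + m ≤ N ∧
        HasRun (T ∪ vertexSegment n b (b + s)) j (j + m) := by
      rcases h with ⟨h1, h2⟩ | ⟨j, h1, h2, h3⟩
      · exact ⟨_, le_rfl, h1, h2⟩
      · exact ⟨j, by omega, h2, h3⟩
    have h4 : ∀ i, b + s ≤ i → j ≤ i → HasRun T i (j + m) := by
      intro i hi hj v h5 h6
      have := h3 v (by omega) h6
      rw [Finset.mem_union, mem_vertexSegment] at this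
      exact this.resolve_right (by omega)
    by_cases hj : b + s + 1 ≤ j
    · exact Or.inr ⟨j, hj, h2, h4 j (by omega) le_rfl⟩
    · exact Or.inl ⟨by omega, (h4 (b + s) le_rfl (by omega)).sub le_rfl (by omega)⟩
  · rintro (⟨h1, h2⟩ | ⟨j, h1, h2, h3⟩)
    · refine Or.inl ⟨by omega, fun v h3 h4 => ?_⟩
      rw [Finset.mem_union, mem_vertexSegment]
      by_cases h5 : v.val < b + s
      · exact Or.inr ⟨by omega, h5⟩
      · exact Or.inl (h2 v (by omega) (by omega))
    · exact Or.inr ⟨j, by omega, h2, h3.mono Finset.subset_union_left⟩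

end Windows

/-! ### Lower bound for depth -/

section Bounds

variable {K : Type*} [Field K] {n m : ℕ}

lemma HasPdLE.pathGens_step {b s N p q : ℕ} (hs : 1 ≤ s) (hsm : s ≤ m) (hsN : b + s ≤ N)
    (hp : HasPdLE K (PathGens (n := n) m (b + 1) m N) p)
    (hq : HasPdLE K (PathGens (n := n) m (b + s) (m + 1 - s) N) q) (h : p ≤ q + 1) :
    HasPdLE K (PathGens (n := n) m b s N) (q + 1) :=
  (hp.or (isUpClosed_pathGens _ _ _ _) (vertexSegment n b (b + s))
    (hq.congr (pathGens_union_vertexSegment hs hsm)) h).congr (pathGens_iff hsN)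

/-- Two applications of the step send s to m+1−s and back to s on a path shorter by m+1, at cost 2.
The bound for s = m is proved alongside because deleting the first vertex leaves a path with that
initial segment. -/
lemma hasPdLE_pathGens (L : ℕ) : ∀ {b s : ℕ}, 1 ≤ s → s ≤ m →
    HasPdLE K (PathGens (n := n) m b s (b + L)) (cycleCodim m L) ∧
    HasPdLE K (PathGens (n := n) m b m (b + L)) (pathCodim m L) := by
  induction L using Nat.strong_induction_on with
  | _ L ih =>
  intro b s hs hsm
  have hm : 1 ≤ m := hs.trans hsm
  have ihp : ∀ L' < L, ∀ b', b' + L' = b + L →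
      HasPdLE K (PathGens (n := n) m b' m (b + L)) (pathCodim m L') := by
    intro L' hL b' hb
    rw [← hb]; exact (ih L' hL hm le_rfl).2
  have ihc : ∀ L' < L, ∀ b' s', b' + L' = b + L → 1 ≤ s' → s' ≤ m →
      HasPdLE K (PathGens (n := n) m b' s' (b + L)) (cycleCodim m L') := by
    intro L' hL b' s' hb h1 h2
    rw [← hb]; exact (ih L' hL h1 h2).1
  constructor
  · by_cases hL : L < s
    · exact .of_false (not_pathGens hsm (by omega)) _
    have e1 := cycleCodim_succ (m := m) (L - 1)
    rw [Nat.sub_add_cancel (by omega)] at e1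
    rw [e1]
    refine .pathGens_step hs hsm (by omega) (ihp (L - 1) (by omega) (b + 1) (by omega)) ?_
      (by omega)
    by_cases hL' : L < m + 1
    · exact .of_false (not_pathGens (by omega) (by omega)) _
    have e2 := cycleCodim_add (m := m) (L - (m + 1))
    rw [Nat.sub_add_cancel (by omega)] at e2
    have h1 : 1 ≤ m + 1 - s := by omega
    have h3 : pathCodim m (L - 1) = cycleCodim m (L - (m + 1)) + 1 := by omega
    rw [h3]
    refine .pathGens_step (p := pathCodim m (L - s - 1)) h1 (by omega) (by omega)
      (ihp _ (by omega) _ (by omega)) ?_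
      ((pathCodim_mono (by omega)).trans h3.le)
    have h2 : m + 1 - (m + 1 - s) = s := by omega
    rw [h2]
    exact ihc _ (by omega) _ _ (by omega) hs hsm
  · by_cases hL : L < m
    · exact .of_false (not_pathGens le_rfl (by omega)) _
    have key : ∃ q, pathCodim m L = q + 1 ∧ pathCodim m (L - 1) ≤ q + 1 ∧
        HasPdLE K (PathGens (n := n) m (b + m) (m + 1 - m) (b + L)) q := by
      by_cases hL' : L = m
      · subst hL'
        refine ⟨0, pathCodim_self, ?_, .of_false (not_pathGens (by omega) (by omega)) _⟩
        rw [zero_add, ← pathCodim_self]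
        exact pathCodim_mono (by omega)
      · have e2 := pathCodim_add (m := m) (L - (m + 1))
        rw [Nat.sub_add_cancel (by omega)] at e2
        refine ⟨pathCodim m (L - (m + 1)) + 1, e2, e2 ▸ pathCodim_mono (by omega), ?_⟩
        refine .pathGens_step (p := pathCodim m (L - (m + 1))) (by omega) (by omega) (by omega)
          (ihp _ (by omega) _ (by omega)) ?_ (by omega)
        have h2 : m + 1 - (m + 1 - m) = m := by omega
        rw [h2]
        exact ihp _ (by omega) _ (by omega)
    obtain ⟨q, e, h1, h2⟩ := key
    rw [e]
    exact .pathGens_step hm le_rfl (by omega) (ihp (L - 1) (by omega) _ (by omega)) h2 h1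

/-- The vertices of the window of length `m` starting with `a`. -/
def window (n m a : ℕ) : Finset (Fin n) := vertexSegment n a (a + m) ∪ vertexSegment n 0 (a + m - n)

lemma cycleGens_succ_iff (a : ℕ) (T : Finset (Fin n)) :
    CycleGens m (a + 1) T ↔ CycleGens m a T ∨ window n m a ⊆ T := by
  rw [window, Finset.union_subset_iff, vertexSegment_subset, vertexSegment_subset]
  constructor
  · rintro ⟨j, h1, h2⟩
    rcases (Nat.lt_succ_iff.1 h1).eq_or_lt with rfl | h1
    · exact Or.inr h2
    · exact Or.inl ⟨j, h1, h2⟩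
  · rintro (⟨j, h1, h2⟩ | h)
    · exact ⟨j, by omega, h2⟩
    · exact ⟨a, by omega, h⟩

/-- Modulo window a, the window at a−1 is reduced to the single variable a−1, which makes every
window through that vertex redundant. What remains is the path on the n−m−1 vertices between window
a and a−1, where the window at 0 has lost all but its last n−a vertices. -/
lemma cycleGens_union_window (hmn : m < n) {a : ℕ} (ha : n < a + m) (han : a < n)
    (T : Finset (Fin n)) :
    CycleGens m a (T ∪ window n m a) ↔
      PathGens m (a + m - n) (n - a) (a - 1) T ∨ {(⟨a - 1, by omega⟩ : Fin n)} ⊆ T := by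
  have hw : ∀ v : Fin n, v ∈ window n m a ↔ a ≤ v.val ∨ v.val < a + m - n := by
    intro v
    have := v.2
    rw [window, Finset.mem_union, mem_vertexSegment, mem_vertexSegment]; omega
  rw [Finset.singleton_subset_iff]
  constructor
  · rintro ⟨j, hj, h1, h2⟩
    by_cases hja : a - 1 < j + m
    · right
      have := h1 ⟨a - 1, by omega⟩ (by simp; omega) hja
      rw [Finset.mem_union, hw] at this
      refine this.resolve_right ?_
      simp only; omega
    · left
      have h4 : ∀ i, a + m - n ≤ i → j ≤ i → HasRun T i (j + m) := by
        intro i hi hj v h5 h6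
        have := h1 v (by omega) h6
        rw [Finset.mem_union, hw] at this
        exact this.resolve_right (by omega)
      by_cases hb : a + m - n + 1 ≤ j
      · exact Or.inr ⟨j, hb, by omega, h4 j (by omega) le_rfl⟩
      · exact Or.inl ⟨by omega, (h4 _ le_rfl (by omega)).sub le_rfl (by omega)⟩
  · rintro ((⟨h1, h2⟩ | ⟨j, h1, h2, h3⟩) | h)
    · refine ⟨0, by omega, fun v h3 h4 => ?_, fun v h3 h4 => by omega⟩
      rw [Finset.mem_union, hw]
      by_cases h5 : v.val < a + m - n
      · exact Or.inr (Or.inr h5)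
      · exact Or.inl (h2 v (by omega) (by omega))
    · exact ⟨j, by omega, h3.mono Finset.subset_union_left, fun v _ _ => by omega⟩
    · refine ⟨a - 1, by omega, fun v h3 h4 => ?_, fun v h3 h4 => ?_⟩ <;>
        rw [Finset.mem_union, hw]
      · by_cases h5 : v.val = a - 1
        · left
          convert h
        · right; omega
      · right; omega

/-- The n−m+1 windows that do not wrap around form a path ideal. Each wrapping window is then added;
its colon ideal has projective dimension at most c(n−m−1) + 1, one less than c(n). -/
lemma hasPdLE_cycleGens (hm : 1 ≤ m) (hmn : m < n) :
    HasPdLE K (CycleGens (n := n) m n) (cycleCodim m n) := by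
  have main : ∀ k, k + (n - m + 1) ≤ n →
      HasPdLE K (CycleGens (n := n) m (k + (n - m + 1))) (cycleCodim m n) := by
    intro k
    induction k with
    | zero =>
      intro _
      have h1 := (hasPdLE_pathGens (K := K) (n := n) (m := m) n (b := 0) hm le_rfl).2
      rw [zero_add] at h1
      refine (h1.mono (pathCodim_le_cycleCodim hm n)).congr fun T => ?_
      rw [zero_add]
      constructor
      · rintro ⟨j, hj, h1, h2⟩
        rcases Nat.eq_zero_or_pos j with rfl | hj0
        · exact Or.inl ⟨by omega, h1⟩
        · exact Or.inr ⟨j, by omega, by omega, h1⟩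
      · rintro (⟨h1, h2⟩ | ⟨j, h1, h2, h3⟩)
        · exact ⟨0, by omega, h2, fun v _ _ => by omega⟩
        · exact ⟨j, by omega, h3, fun v _ _ => by omega⟩
    | succ k ih =>
      intro hk
      set a := k + (n - m + 1) with ha
      have e := cycleCodim_add (m := m) (n - (m + 1))
      rw [Nat.sub_add_cancel (by omega)] at e
      have ih := ih (by omega)
      have h1 := (hasPdLE_pathGens (K := K) (n := n) (m := m) (n - (m + 1))
        (b := a + m - n) (s := n - a) (by omega) (by omega)).1
      have h2 : a + m - n + (n - (m + 1)) = a - 1 := by omega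
      rw [h2] at h1
      -- The variable a−1 does not occur in the path generators, so the colon by it changes nothing
      -- and it adds exactly one to the bound.
      have h3 := h1.or (isUpClosed_pathGens _ _ _ _) {(⟨a - 1, by omega⟩ : Fin n)}
        (h1.congr fun T => ?_) (by omega)
      · rw [e] at ih ⊢
        have h4 := ih.or (isUpClosed_cycleGens _ _) (window n m a)
          (h3.congr (cycleGens_union_window hmn (by omega) (by omega))) (by omega)
        have h5 : k + 1 + (n - m + 1) = a + 1 := by omega
        rw [h5]
        exact h4.congr (cycleGens_succ_iff a)
      · have h6 : ∀ (i l : ℕ), l ≤ a - 1 →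
            (HasRun (T ∪ {(⟨a - 1, by omega⟩ : Fin n)}) i l ↔ HasRun T i l) := by
          intro i l hl
          refine ⟨fun h v h1 h2 => ?_, fun h => h.mono Finset.subset_union_left⟩
          have := h v h1 h2
          rw [Finset.mem_union, Finset.mem_singleton, Fin.ext_iff] at this
          exact this.resolve_right (by simp only; omega)
        rw [PathGens, PathGens]
        refine or_congr (and_congr_right fun h => h6 _ _ h) (exists_congr fun j =>
          and_congr_right fun _ => and_congr_right fun h => h6 _ _ h)
  have := main (m - 1) (by omega)
  have h : m - 1 + (n - m + 1) = n := by omega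
  rwa [h] at this

end Bounds

/-! ### Cohomology of convex families of sets -/

section SimplicialCohomology

variable {σ K : Type*} [LinearOrder σ] [Field K]

/-- The simplicial coboundary of a cochain. -/
def coboundary (c : Finset σ → K) (F : Finset σ) : K := koszulD (fun _ : σ => (1 : K)) c F

/-- Vanishing of the cohomology of a family `X` of finite sets in cardinality `i`, with
coefficients in `K`. -/
def IsAcyclicAt (K : Type*) {σ : Type*} [LinearOrder σ] [Field K] (X : Finset σ → Prop)
    (i : ℕ) : Prop :=
  ∀ c : Finset σ → K, (∀ F, ¬ X F → c F = 0) →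
    (∀ F, X F → F.card = i + 1 → coboundary c F = 0) →
    ∃ e : Finset σ → K, (∀ F, ¬ X F → e F = 0) ∧ ∀ F, X F → F.card = i → c F = coboundary e F

/-- Convex families of finite sets. -/
def IsConvexFamily (X : Finset σ → Prop) : Prop :=
  ∀ ⦃F G H : Finset σ⦄, F ⊆ G → G ⊆ H → X F → X H → X G

lemma coboundary_congr {c e : Finset σ → K} {F : Finset σ}
    (h : ∀ j ∈ F, c (F.erase j) = e (F.erase j)) : coboundary c F = coboundary e F :=
  Finset.sum_congr rfl fun j hj => by rw [h j hj]

lemma coboundary_eq_zero {c : Finset σ → K} {F : Finset σ}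
    (h : ∀ j ∈ F, c (F.erase j) = 0) : coboundary c F = 0 :=
  Finset.sum_eq_zero fun j hj => by rw [h j hj, smul_zero, smul_zero]

lemma coboundary_sub (c e : Finset σ → K) (F : Finset σ) :
    coboundary (fun G => c G - e G) F = coboundary c F - coboundary e F := koszulD_sub _ _ _ _

lemma coboundary_add (c e : Finset σ → K) (F : Finset σ) :
    coboundary (fun G => c G + e G) F = coboundary c F + coboundary e F := koszulD_add _ _ _ _

lemma coboundary_coboundary (c : Finset σ → K) (F : Finset σ) :
    coboundary (coboundary c) F = 0 := koszulD_koszulD _ _ _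

lemma IsConvexFamily.coboundary_erase {X : Finset σ → Prop} (hX : IsConvexFamily X)
    {b : Finset σ → K} (hb : ∀ F, ¬ X F → b F = 0) {F : Finset σ} (hF : X F) {j : σ}
    (hj : ¬ X (F.erase j)) : coboundary b (F.erase j) = 0 := by
  refine coboundary_eq_zero fun k _ => hb _ fun h => hj ?_
  exact hX (Finset.erase_subset _ _) (Finset.erase_subset _ _) h hF

section Splitting

variable {X W : Finset σ → Prop} (hX : IsConvexFamily X)
  (hW : ∀ ⦃F G : Finset σ⦄, F ⊆ G → X F → X G → W F → W G)

include hX hW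

open Classical in
-- As W is upward closed in X, cochains supported on W form a subcomplex with quotient the cochains
-- off W. This lemma, `IsAcyclicAt.upper` and `IsAcyclicAt.lower` are the pieces of the resulting
-- long exact sequence about the middle, the sub and the quotient. Convexity makes each piece a
-- complex in its own right.
lemma IsAcyclicAt.of_split {i : ℕ} (h1 : IsAcyclicAt K (fun F => X F ∧ W F) i)
    (h2 : IsAcyclicAt K (fun F => X F ∧ ¬ W F) i) : IsAcyclicAt K X i := by
  intro c hc hcc
  obtain ⟨e2, he2, he2'⟩ := h2 (fun F => if X F ∧ ¬ W F then c F else 0)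
    (fun F hF => if_neg hF) (fun F hF hi => by
      refine (coboundary_congr (e := c) fun j hj => ?_).trans (hcc F hF.1 hi)
      split_ifs with h
      · rfl
      · refine (hc _ fun h' => h ⟨h', fun hw => hF.2 ?_⟩).symm
        exact hW (Finset.erase_subset _ _) h' hF.1 hw)
  have he2X : ∀ F, ¬ X F → e2 F = 0 := fun F hF => he2 F fun h => hF h.1
  -- Subtracting the coboundary of the primitive found off W leaves a cocycle supported on W.
  obtain ⟨e1, he1, he1'⟩ := h1 (fun F => if X F ∧ W F then c F - coboundary e2 F else 0)
    (fun F hF => if_neg hF) (fun F hF hi => by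
      rw [coboundary_congr (e := fun G => c G - coboundary e2 G), coboundary_sub,
        coboundary_coboundary, hcc F hF.1 hi, sub_zero]
      intro j hj
      split_ifs with h
      · rfl
      · by_cases hx : X (F.erase j)
        · have hw : ¬ W (F.erase j) := fun hw => h ⟨hx, hw⟩
          have := he2' _ ⟨hx, hw⟩ (by have := Finset.card_erase_add_one hj; omega)
          rw [if_pos ⟨hx, hw⟩] at this
          rw [this, sub_self]
        · rw [hc _ hx, hX.coboundary_erase he2X hF.1 hx, sub_self])
  refine ⟨fun F => e1 F + e2 F, fun F hF => ?_, fun F hF hi => ?_⟩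
  · simp only [he1 F (fun h => hF h.1), he2X F hF, add_zero]
  · rw [coboundary_add]
    by_cases hw : W F
    · have := he1' F ⟨hF, hw⟩ hi
      rw [if_pos ⟨hF, hw⟩] at this
      rw [← this, sub_add_cancel]
    · have := he2' F ⟨hF, hw⟩ hi
      rw [if_pos ⟨hF, hw⟩] at this
      rw [← this, coboundary_eq_zero, zero_add]
      intro j hj
      exact he1 _ fun h => hw (hW (Finset.erase_subset _ _) h.1 hF h.2)

open Classical in
-- The obstruction is the connecting map from cardinality i−1 of the quotient, which is absent for i
-- = 0.
lemma IsAcyclicAt.upper {i : ℕ} (h : IsAcyclicAt K X i)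
    (h2 : i = 0 ∨ IsAcyclicAt K (fun F => X F ∧ ¬ W F) (i - 1)) :
    IsAcyclicAt K (fun F => X F ∧ W F) i := by
  intro c hc hcc
  have hcX : ∀ F, ¬ X F → c F = 0 := fun F hF => hc F fun h => hF h.1
  have hlow : ∀ F, X F → ¬ W F → ∀ j ∈ F, ¬ (X (F.erase j) ∧ W (F.erase j)) :=
    fun F hF hw j _ h => hw (hW (Finset.erase_subset _ _) h.1 hF h.2)
  obtain ⟨e, he, he'⟩ := h c hcX (fun F hF hi => by
    by_cases hw : W F
    · exact hcc F ⟨hF, hw⟩ hi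
    · exact coboundary_eq_zero fun j hj => hc _ (hlow F hF hw j hj))
  rcases h2 with rfl | h2
  · refine ⟨fun _ => 0, fun _ _ => rfl, fun F hF hi => ?_⟩
    rw [he' F hF.1 hi, Finset.card_eq_zero.1 hi]
    simp [coboundary, koszulD]
  cases i with
  | zero =>
    refine ⟨fun _ => 0, fun _ _ => rfl, fun F hF hi => ?_⟩
    rw [he' F hF.1 hi, Finset.card_eq_zero.1 hi]
    simp [coboundary, koszulD]
  | succ i =>
    obtain ⟨b, hb, hb'⟩ := h2 (fun F => if X F ∧ ¬ W F then e F else 0)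
      (fun F hF => if_neg hF) (fun F hF hi => by
        have h0 : c F = 0 := hc F fun h => hF.2 h.2
        refine (coboundary_congr (e := e) fun j hj => ?_).trans
          ((he' F hF.1 (by omega)).symm.trans h0)
        split_ifs with h
        · rfl
        · by_cases hx : X (F.erase j)
          · exact absurd ⟨hx, not_not.1 fun hw => h ⟨hx, hw⟩⟩ (hlow F hF.1 hF.2 j hj)
          · exact (he _ hx).symm)
    have hbX : ∀ F, ¬ X F → b F = 0 := fun F hF => hb F fun h => hF h.1
    refine ⟨fun F => if X F ∧ W F then e F - coboundary b F else 0,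
      fun F hF => if_neg hF, fun F hF hi => ?_⟩
    rw [coboundary_congr (e := fun G => e G - coboundary b G), coboundary_sub,
      coboundary_coboundary, he' F hF.1 hi, sub_zero]
    intro j hj
    split_ifs with h
    · rfl
    · by_cases hx : X (F.erase j)
      · have hw : ¬ W (F.erase j) := fun hw => h ⟨hx, hw⟩
        have := hb' _ ⟨hx, hw⟩ (by have := Finset.card_erase_add_one hj; omega)
        rw [if_pos ⟨hx, hw⟩] at this
        rw [this, sub_self]
      · rw [he _ hx, hX.coboundary_erase hbX hF.1 hx, sub_self]

open Classical in
lemma IsAcyclicAt.lower {i : ℕ} (h : IsAcyclicAt K X i)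
    (h1 : IsAcyclicAt K (fun F => X F ∧ W F) (i + 1)) :
    IsAcyclicAt K (fun F => X F ∧ ¬ W F) i := by
  intro c hc hcc
  have hcX : ∀ F, ¬ X F → c F = 0 := fun F hF => hc F fun h => hF h.1
  have hlow : ∀ F, X F → ¬ W F → ∀ j ∈ F, ¬ (X (F.erase j) ∧ W (F.erase j)) :=
    fun F hF hw j _ h => hw (hW (Finset.erase_subset _ _) h.1 hF h.2)
  obtain ⟨b, hb, hb'⟩ := h1 (fun F => if X F ∧ W F then coboundary c F else 0)
    (fun F hF => if_neg hF) (fun F hF hi => by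
      rw [coboundary_congr (e := coboundary c), coboundary_coboundary]
      intro j hj
      split_ifs with h
      · rfl
      · by_cases hx : X (F.erase j)
        · exact (hcc _ ⟨hx, fun hw => h ⟨hx, hw⟩⟩
            (by have := Finset.card_erase_add_one hj; omega)).symm
        · exact (hX.coboundary_erase hcX hF.1 hx).symm)
  have hbX : ∀ F, ¬ X F → b F = 0 := fun F hF => hb F fun h => hF h.1
  obtain ⟨e, he, he'⟩ := h (fun F => c F - b F)
    (fun F hF => by rw [hcX F hF, hbX F hF, sub_zero]) (fun F hF hi => by
      rw [coboundary_sub]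
      by_cases hw : W F
      · have := hb' F ⟨hF, hw⟩ hi
        rw [if_pos ⟨hF, hw⟩] at this
        rw [this, sub_self]
      · rw [hcc F ⟨hF, hw⟩ hi, coboundary_eq_zero, sub_zero]
        exact fun j hj => hb _ (hlow F hF hw j hj))
  refine ⟨fun F => if X F ∧ ¬ W F then e F else 0, fun F hF => if_neg hF, fun F hF hi => ?_⟩
  have := he' F hF.1 hi
  rw [hb F (fun h => hF.2 h.2), sub_zero] at this
  rw [this]
  refine coboundary_congr fun j hj => ?_
  split_ifs with h
  · rfl
  · by_cases hx : X (F.erase j)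
    · exact absurd ⟨hx, not_not.1 fun hw => h ⟨hx, hw⟩⟩ (hlow F hF.1 hF.2 j hj)
    · exact he _ hx

end Splitting

/-- The family is a cone with apex v, and contraction along v is a contracting homotopy. -/
lemma IsAcyclicAt.of_toggle {X : Finset σ → Prop} (v : σ)
    (h : ∀ F, v ∉ F → (X F ↔ X (insert v F))) (i : ℕ) : IsAcyclicAt K X i := by
  intro c hc hcc
  refine ⟨koszulH v c, fun F hF => ?_, fun F hF hi => ?_⟩
  · rw [koszulH]
    split_ifs with hv
    · rfl
    · rw [hc _ (fun h' => hF ((h F hv).2 h')), smul_zero]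
  · have h1 := koszulD_koszulH_add (fun _ : σ => (1 : K)) v c F
    rw [one_smul] at h1
    rw [← h1, coboundary, add_eq_left, koszulH]
    split_ifs with hv
    · rfl
    · have := hcc _ ((h F hv).1 hF) (by rw [Finset.card_insert_of_notMem hv, hi])
      rw [coboundary] at this
      rw [this, smul_zero]

lemma isAcyclicAt_singleton_iff {X : Finset σ → Prop} {P : Finset σ} (hX : ∀ F, X F ↔ F = P)
    (i : ℕ) : IsAcyclicAt K X i ↔ i ≠ P.card := by
  constructor
  · rintro h rfl
    obtain ⟨e, he, he'⟩ := h (fun F => if F = P then 1 else 0)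
      (fun F hF => if_neg fun h => hF ((hX F).2 h)) (fun F hF hi => by
        rw [(hX F).1 hF] at hi; omega)
    have := he' P ((hX P).2 rfl) rfl
    rw [if_pos rfl, coboundary_eq_zero] at this
    · exact one_ne_zero this
    · intro j hj
      refine he _ fun h => ?_
      have := (hX _).1 h
      exact Finset.notMem_erase j P (this.symm ▸ hj)
  · intro h c hc _
    refine ⟨fun _ => 0, fun _ _ => rfl, fun F hF hi => ?_⟩
    rw [(hX F).1 hF] at hi
    exact absurd hi.symm h

lemma IsAcyclicAt.congr {X Y : Finset σ → Prop} {i : ℕ} (h : IsAcyclicAt K X i)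
    (hXY : ∀ F, Y F ↔ X F) : IsAcyclicAt K Y i := by
  obtain rfl : Y = X := funext fun T => propext (hXY T)
  exact h

/-- The squarefree part of the Koszul complex of `S / I_U` is the simplicial cochain complex of
the family of sets without the property `U`. -/
lemma KoszulExact.isAcyclicAt {U : Finset σ → Prop} (hU : IsUpClosed U) {i : ℕ}
    (h : KoszulExact (X : σ → MvPolynomial σ K) (MvPolynomial σ K ⧸ sqfreeIdeal K U) i) :
    IsAcyclicAt K (fun F => ¬ U F) i := by
  classical
  intro c hc hcc
  -- Giving the cochain value at F the multidegree of F identifies one multigraded strand of the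
  -- Koszul complex with the simplicial cochains.
  let C : Finset σ → MvPolynomial σ K := fun F => monomial (sqfreeExp F) (c F)
  have hC : ∀ F, koszulD (X : σ → MvPolynomial σ K) C F = monomial (sqfreeExp F) (coboundary c F) := by
    intro F
    rw [coboundary, koszulD, koszulD, map_sum]
    refine Finset.sum_congr rfl fun j hj => ?_
    rw [one_smul, map_zsmul, smul_eq_mul, sqfreeExp_erase hj, X, monomial_mul, one_mul]
  obtain ⟨E, hE⟩ := h (fun F => Submodule.mkQ (sqfreeIdeal K U) (C F)) (fun F hF => by
    rw [koszulD_map, hC, Submodule.mkQ_apply, Submodule.Quotient.mk_eq_zero,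
      mem_sqfreeIdeal hU]
    intro u hu
    rw [coeff_monomial] at hu
    split_ifs at hu with h1
    · rw [← h1, support_sqfreeExp]
      by_contra hUF
      exact hu (hcc F hUF hF)
    · exact absurd rfl hu)
  choose l hl using Submodule.mkQ_surjective (sqfreeIdeal K U)
  refine ⟨fun F => if U F then 0 else coeff (sqfreeExp F) (l (E F)),
    fun F hF => if_pos (not_not.1 hF), fun F hF hi => ?_⟩
  have h1 := hE F hi
  rw [show E = fun G => Submodule.mkQ (sqfreeIdeal K U) (l (E G)) from
    funext fun G => (hl _).symm, koszulD_map, ← sub_eq_zero, ← map_sub, Submodule.mkQ_apply,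
    Submodule.Quotient.mk_eq_zero, mem_sqfreeIdeal hU] at h1
  have h2 : coeff (sqfreeExp F) (C F - koszulD (X : σ → MvPolynomial σ K) (fun G => l (E G)) F) = 0 := by
    by_contra hne
    have := h1 _ hne
    rw [support_sqfreeExp] at this
    exact hF this
  rw [coeff_sub, coeff_monomial, if_pos rfl, sub_eq_zero] at h2
  rw [h2, koszulD, coeff_sum, coboundary, koszulD]
  refine Finset.sum_congr rfl fun j hj => ?_
  rw [if_neg (fun hu => hF (hU (Finset.erase_subset _ _) hu)), one_smul, smul_eq_mul]
  have h3 : coeff (sqfreeExp F) ((X j : MvPolynomial σ K) * l (E (F.erase j))) =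
      coeff (sqfreeExp (F.erase j)) (l (E (F.erase j))) := by
    rw [sqfreeExp_erase hj]
    exact (coeff_monomial_mul _ _ _ _).trans (one_mul _)
  rw [← h3]
  exact map_zsmul (lcoeff K (sqfreeExp F)) _ _

end SimplicialCohomology

/-! ### Cohomology of the window-free sets of a path -/

section CriticalCells

variable {n m : ℕ}

lemma cycleCodim_mul_add (k r : ℕ) : cycleCodim m ((m + 1) * k + r) = 2 * k + cycleCodim m r := by
  induction k with
  | zero => simp
  | succ k ih =>
    rw [show (m + 1) * (k + 1) + r = (m + 1) * k + r + (m + 1) by ring, cycleCodim_add, ih]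
    ring

lemma cycleCodim_of_le {r : ℕ} (h1 : 1 ≤ r) (h2 : r ≤ m) : cycleCodim m r = 1 := by
  have h3 : (r + m) / (m + 1) = 1 := by
    rw [show r + m = (r - 1) + (m + 1) by omega, Nat.add_div_right _ m.succ_pos,
      Nat.div_eq_of_lt (by omega)]
  rw [cycleCodim, Nat.div_eq_of_lt (by omega), h3]

/-- The sets that agree with `P` off the path on the vertices `b ≤ v < N` and satisfy none of the
conditions `PathGens`. -/
def PathFaces (m b s N : ℕ) (P F : Finset (Fin n)) : Prop :=
  (∀ v : Fin n, v.val < b ∨ N ≤ v.val → (v ∈ F ↔ v ∈ P)) ∧ ¬ PathGens m b s N F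

lemma card_vertexSegment {i l : ℕ} (h : l ≤ n) : (vertexSegment n i l).card = l - i := by
  rw [← Nat.card_Ico, ← Finset.card_map Fin.valEmbedding]
  congr 1
  ext v
  simp only [Finset.mem_map, mem_vertexSegment, Fin.valEmbedding_apply, Finset.mem_Ico]
  constructor
  · rintro ⟨v, hv, rfl⟩; exact hv
  · intro hv; exact ⟨⟨v, by omega⟩, hv, rfl⟩

lemma isConvexFamily_pathFaces (m b s N : ℕ) (P : Finset (Fin n)) :
    IsConvexFamily (PathFaces m b s N P) := by
  rintro F G H hFG hGH ⟨h1, -⟩ ⟨h3, h4⟩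
  refine ⟨fun v hv => ⟨fun h => (h3 v hv).1 (hGH h), fun h => hFG ((h1 v hv).2 h)⟩,
    fun h => h4 (isUpClosed_pathGens m b s N hGH h)⟩

lemma HasRun.insert_iff {F : Finset (Fin n)} {v : Fin n} {i l : ℕ} (h : v.val < i ∨ l ≤ v.val) :
    HasRun (insert v F) i l ↔ HasRun F i l := by
  refine ⟨fun h' w h1 h2 => ?_, fun h' => h'.mono (Finset.subset_insert _ _)⟩
  refine (Finset.mem_insert.1 (h' w h1 h2)).resolve_left ?_
  rintro rfl
  omega

variable {K : Type*} [Field K]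

/-- The path is nonempty but too short for any generator, so its first vertex can be toggled freely.
-/
lemma isAcyclicAt_pathFaces_of_lt {b s N : ℕ} (hsm : s ≤ m) (hbN : b < N) (hN : N ≤ n)
    (h : N < b + s) (P : Finset (Fin n)) (i : ℕ) :
    IsAcyclicAt K (PathFaces m b s N P) i := by
  refine .of_toggle (⟨b, by omega⟩ : Fin n) (fun F hF => ?_) i
  refine and_congr (forall_congr' fun v => ?_) (iff_of_true (not_pathGens hsm h _)
    (not_pathGens hsm h _))
  refine imp_congr_right fun hv => ?_
  rw [Finset.mem_insert, or_iff_right]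
  rintro rfl
  simp only at hv
  omega

/-- Split on whether F contains [b+1, b+s). If not, b can be toggled and that part is acyclic. If
so, b is excluded, the s−1 vertices become part of the fixed set, and the recursion continues from
b+s with initial segment m+1−s. -/
lemma isAcyclicAt_pathFaces_step {b s N : ℕ} (hs : 1 ≤ s) (hsm : s ≤ m) (hsN : b + s ≤ N)
    (hN : N ≤ n) {P : Finset (Fin n)} (hP : ∀ v ∈ P, v.val < b ∨ N ≤ v.val) (i : ℕ) :
    IsAcyclicAt K (PathFaces m b s N P) i ↔ IsAcyclicAt K
      (PathFaces m (b + s) (m + 1 - s) N (P ∪ vertexSegment n (b + 1) (b + s))) i := by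
  have hX := isConvexFamily_pathFaces m b s N P
  have hW : ∀ ⦃F G : Finset (Fin n)⦄, F ⊆ G → PathFaces m b s N P F → PathFaces m b s N P G →
      HasRun F (b + 1) (b + s) → HasRun G (b + 1) (b + s) := fun F G h _ _ h' => h'.mono h
  have hlow : ∀ i, IsAcyclicAt K
      (fun F => PathFaces m b s N P F ∧ ¬ HasRun F (b + 1) (b + s)) i := by
    intro i
    refine .of_toggle (⟨b, by omega⟩ : Fin n) (fun F hF => ?_) i
    have hins : ∀ {i l : ℕ}, b < i →
        (HasRun (insert (⟨b, by omega⟩ : Fin n) F) i l ↔ HasRun F i l) :=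
      fun h => HasRun.insert_iff (Or.inl h)
    rw [hins (Nat.lt_succ_self b)]
    refine and_congr_left fun hw => and_congr (forall_congr' fun v => imp_congr_right fun hv => ?_)
      (not_congr (or_congr (and_congr_right fun _ => iff_of_false (fun h => hw ?_)
        (fun h => hw ?_)) (exists_congr fun j => and_congr_right fun hj =>
          and_congr_right fun _ => (hins hj).symm)))
    · rw [Finset.mem_insert, or_iff_right]
      rintro rfl
      simp only at hv
      omega
    · exact h.sub (by omega) le_rfl
    · exact (hins (Nat.lt_succ_self b)).1 (h.sub (by omega) le_rfl)
  have hup : ∀ F, PathFaces m (b + s) (m + 1 - s) N (P ∪ vertexSegment n (b + 1) (b + s)) F ↔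
      PathFaces m b s N P F ∧ HasRun F (b + 1) (b + s) := by
    intro F
    have hb : ∀ v : Fin n, v.val = b → v ∉ P ∪ vertexSegment n (b + 1) (b + s) := by
      intro v hv h
      rw [Finset.mem_union, mem_vertexSegment] at h
      rcases h with h | h
      · have := hP v h; omega
      · omega
    constructor
    · rintro ⟨h1, h2⟩
      have hrun : HasRun F (b + 1) (b + s) := fun v h3 h4 =>
        (h1 v (by omega)).2 (Finset.mem_union_right _ (mem_vertexSegment.2 ⟨h3, h4⟩))
      refine ⟨⟨fun v hv => ?_, ?_⟩, hrun⟩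
      · rw [h1 v (by omega), Finset.mem_union, mem_vertexSegment, or_iff_left (by omega)]
      · rintro (⟨h3, h4⟩ | ⟨j, h3, h4, h5⟩)
        · exact hb ⟨b, by omega⟩ rfl ((h1 _ (Or.inl (by simp only; omega))).1
            (h4 ⟨b, by omega⟩ le_rfl (by simp only; omega)))
        · by_cases hj : b + s + 1 ≤ j
          · exact h2 (Or.inr ⟨j, hj, h4, h5⟩)
          · exact h2 (Or.inl ⟨by omega, h5.sub (by omega) (by omega)⟩)
    · rintro ⟨⟨h1, h2⟩, hrun⟩
      have hbF : ∀ v : Fin n, v.val = b → v ∉ F := by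
        intro v hv hvF
        refine h2 (Or.inl ⟨hsN, fun w h3 h4 => ?_⟩)
        rcases h3.eq_or_lt with h3 | h3
        · rwa [show w = v from Fin.ext (by omega)]
        · exact hrun w h3 h4
      refine ⟨fun v hv => ?_, ?_⟩
      · rw [Finset.mem_union, mem_vertexSegment]
        by_cases hvb : v.val = b
        · refine iff_of_false (hbF v hvb) ?_
          rintro (h | h)
          · have := hP v h; omega
          · omega
        · by_cases hv' : b < v.val ∧ v.val < b + s
          · exact iff_of_true (hrun v hv'.1 hv'.2) (Or.inr hv')
          · rw [h1 v (by omega), or_iff_left (by omega)]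
      · rintro (⟨h3, h4⟩ | ⟨j, h3, h4, h5⟩)
        · refine h2 (Or.inr ⟨b + 1, le_rfl, by omega, fun v h5 h6 => ?_⟩)
          by_cases hv : v.val < b + s
          · exact hrun v h5 hv
          · exact h4 v (by omega) (by omega)
        · exact h2 (Or.inr ⟨j, by omega, h4, h5⟩)
  constructor
  · intro h
    exact (h.upper hX hW (Or.inr (hlow _))).congr hup
  · intro h
    exact .of_split hX hW (h.congr fun F => (hup F).symm) (hlow _)

lemma card_union_vertexSegment {b i l N : ℕ} (hl : l ≤ N) (hN : N ≤ n) (hbi : b ≤ i)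
    {P : Finset (Fin n)} (hP : ∀ v ∈ P, v.val < b ∨ N ≤ v.val) :
    (P ∪ vertexSegment n i l).card = P.card + (l - i) := by
  rw [Finset.card_union_of_disjoint, card_vertexSegment (hl.trans hN)]
  rw [Finset.disjoint_left]
  intro v hv h
  rw [mem_vertexSegment] at h
  have := hP v hv
  omega

lemma union_vertexSegment_outside {b i l c N : ℕ} (hl : l ≤ c) (hbc : b ≤ c)
    {P : Finset (Fin n)} (hP : ∀ v ∈ P, v.val < b ∨ N ≤ v.val) :
    ∀ v ∈ P ∪ vertexSegment n i l, v.val < c ∨ N ≤ v.val := by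
  intro v hv
  rw [Finset.mem_union, mem_vertexSegment] at hv
  rcases hv with hv | hv
  · have := hP v hv; omega
  · omega

lemma isAcyclicAt_pathFaces_self {b s : ℕ} (hs : 1 ≤ s) (hsm : s ≤ m) 
    {P : Finset (Fin n)} (i : ℕ) :
    IsAcyclicAt K (PathFaces m b s b P) i ↔ i ≠ P.card := by
  refine isAcyclicAt_singleton_iff (fun F => ⟨fun h => ?_, ?_⟩) i
  · ext v; exact h.1 v (lt_or_ge _ _)
  · rintro rfl
    exact ⟨fun _ _ => Iff.rfl, not_pathGens hsm (by omega) _⟩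

/-- Each period of m+1 vertices fixes (s−1) + (m−s) = m−1 of them. The remainder r decides the
outcome: for r = 0 a single set is left, for r = s one further half step leaves a single set with
s−1 more elements, and otherwise the rest is a cone. -/
lemma isAcyclicAt_pathFaces_iff (k r : ℕ) (hr : r ≤ m) : ∀ {b s N : ℕ}, 1 ≤ s → s ≤ m → N ≤ n →
    b + ((m + 1) * k + r) = N → ∀ {P : Finset (Fin n)}, (∀ v ∈ P, v.val < b ∨ N ≤ v.val) →
    ∀ i, (IsAcyclicAt K (PathFaces m b s N P) i ↔
      ¬ (r = 0 ∧ i = P.card + k * (m - 1) ∨ r = s ∧ i = P.card + k * (m - 1) + (s - 1))) := by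
  induction k with
  | zero =>
    intro b s N hs hsm hN hbN P hP i
    simp only [mul_zero, zero_add, zero_mul, add_zero] at hbN ⊢
    rcases Nat.eq_zero_or_pos r with rfl | hr0
    · obtain rfl : b = N := hbN
      rw [isAcyclicAt_pathFaces_self hs hsm]
      have : (0 : ℕ) ≠ s := by omega
      simp [this]
    by_cases hrs : r < s
    · refine iff_of_true (isAcyclicAt_pathFaces_of_lt hsm (by omega) hN (by omega) P i) ?_
      omega
    rw [isAcyclicAt_pathFaces_step hs hsm (by omega) hN hP]
    by_cases h : r = s
    · subst h
      obtain rfl : b + r = N := hbN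
      rw [isAcyclicAt_pathFaces_self (by omega) (by omega),
        card_union_vertexSegment le_rfl hN (by omega) hP]
      omega
    · refine iff_of_true (isAcyclicAt_pathFaces_of_lt (by omega) (by omega) hN (by omega) _ i) ?_
      omega
  | succ k ih =>
    intro b s N hs hsm hN hbN P hP i
    have e : (m + 1) * (k + 1) = (m + 1) * k + (m + 1) := by ring
    have e' : (k + 1) * (m - 1) = k * (m - 1) + (m - 1) := by ring
    rw [e] at hbN
    rw [e']
    have hP1 := union_vertexSegment_outside (i := b + 1) (l := b + s) (c := b + s) le_rfl
      (by omega) hP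
    have hP2 := union_vertexSegment_outside (i := b + s + 1) (l := b + s + (m + 1 - s))
      (c := b + s + (m + 1 - s)) le_rfl (by omega) hP1
    rw [isAcyclicAt_pathFaces_step hs hsm (by omega) hN hP,
      isAcyclicAt_pathFaces_step (by omega) (by omega) (by omega) hN hP1,
      show m + 1 - (m + 1 - s) = s by omega,
      ih hs hsm hN (by omega) hP2,
      card_union_vertexSegment (by omega) hN (by omega) hP1,
      card_union_vertexSegment (by omega) hN (by omega) hP]
    omega

end CriticalCells

/-! ### Nonvanishing cohomology for the cycle -/

section CycleCohomology

variable {K : Type*} [Field K] {n m : ℕ}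

/-- In a set ending with exactly t vertices, n−t−1 is absent and cuts the cycle open. The t final
vertices complete any run of m−t vertices at 0 to a window, which explains the initial segment of
length m−t. -/
lemma cycleFaces_split {t : ℕ} (ht : t < m) (hmn : m < n) (F : Finset (Fin n)) :
    ((¬ CycleGens m n F ∧ HasRun F (n - t) n) ∧ ¬ HasRun F (n - (t + 1)) n) ↔
      PathFaces m 0 (m - t) (n - t - 1) (vertexSegment n (n - t) n) F := by
  have key : (⟨n - t - 1, by omega⟩ : Fin n) ∉ F → HasRun F (n - t) n →
      (CycleGens m n F ↔ PathGens m 0 (m - t) (n - t - 1) F) := by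
    intro hN hrun
    constructor
    · rintro ⟨j, hj, h1, h2⟩
      by_cases h3 : j + m ≤ n - t - 1
      · rcases Nat.eq_zero_or_pos j with rfl | hj0
        · exact Or.inl ⟨by omega, h1.sub le_rfl (by omega)⟩
        · exact Or.inr ⟨j, hj0, h3, h1⟩
      · by_cases h4 : j ≤ n - t - 1
        · exact absurd (h1 _ h4 (by simp only; omega)) hN
        · exact Or.inl ⟨by omega, h2.sub le_rfl (by omega)⟩
    · rintro (⟨h1, h2⟩ | ⟨j, h1, h2, h3⟩)
      · rcases Nat.eq_zero_or_pos t with rfl | ht0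
        · exact ⟨0, by omega, h2.sub le_rfl (by omega), fun v _ _ => by omega⟩
        · exact ⟨n - t, by omega, fun v h3 _ => hrun v h3 v.2, h2.sub le_rfl (by omega)⟩
      · exact ⟨j, by omega, h3, fun v _ _ => by omega⟩
  constructor
  · rintro ⟨⟨h1, h2⟩, h3⟩
    have hN : (⟨n - t - 1, by omega⟩ : Fin n) ∉ F := by
      refine fun h => h3 fun v h4 h5 => ?_
      by_cases h6 : v.val = n - t - 1
      · rwa [show v = ⟨n - t - 1, by omega⟩ from Fin.ext h6]
      · exact h2 v (by omega) h5
    refine ⟨fun v hv => ?_, fun h => h1 ((key hN h2).2 h)⟩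
    rw [mem_vertexSegment]
    by_cases h6 : v.val = n - t - 1
    · refine iff_of_false ?_ (by omega)
      rwa [show v = ⟨n - t - 1, by omega⟩ from Fin.ext h6]
    · exact iff_of_true (h2 v (by omega) v.2) (by omega)
  · rintro ⟨h1, h2⟩
    have hN : (⟨n - t - 1, by omega⟩ : Fin n) ∉ F := by
      rw [h1 _ (Or.inr le_rfl), mem_vertexSegment]
      simp only; omega
    have hrun : HasRun F (n - t) n := fun v h3 h4 =>
      (h1 v (Or.inr (by omega))).2 (mem_vertexSegment.2 ⟨h3, h4⟩)
    exact ⟨⟨fun h => h2 ((key hN hrun).1 h), hrun⟩,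
      fun h => hN (h _ (by simp only; omega) (by simp only; omega))⟩

/-- The two critical remainders for the path on n−t−1 vertices are r = 0 and r = m−t, that is, n ≡
t+1 and n ≡ 0 modulo m+1. Both place the class in the same cardinality n − c(n). -/
lemma isAcyclicAt_cycleFaces_split (hm : 1 ≤ m) (hmn : m < n) {t : ℕ} (ht : t < m) (i : ℕ) :
    IsAcyclicAt K (fun F : Finset (Fin n) =>
      (¬ CycleGens m n F ∧ HasRun F (n - t) n) ∧ ¬ HasRun F (n - (t + 1)) n) i ↔
    ¬ (i + cycleCodim m n = n ∧ (n % (m + 1) = 0 ∨ n % (m + 1) = t + 1)) := by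
  have hdm := Nat.div_add_mod (n - t - 1) (m + 1)
  have hlt := Nat.mod_lt (n - t - 1) m.succ_pos
  set k := (n - t - 1) / (m + 1)
  set r := (n - t - 1) % (m + 1)
  have h1 := isAcyclicAt_pathFaces_iff (K := K) (n := n) (m := m) k r (by omega) (b := 0)
    (s := m - t) (N := n - t - 1) (by omega) (by omega) (by omega) (by omega)
    (P := vertexSegment n (n - t) n) (fun v hv => by
      rw [mem_vertexSegment] at hv; omega) i
  rw [card_vertexSegment le_rfl] at h1
  have h2 : IsAcyclicAt K (fun F : Finset (Fin n) =>
      (¬ CycleGens m n F ∧ HasRun F (n - t) n) ∧ ¬ HasRun F (n - (t + 1)) n) i ↔ IsAcyclicAt K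
      (PathFaces m 0 (m - t) (n - t - 1) (vertexSegment n (n - t) n)) i :=
    ⟨fun h => h.congr fun F => (cycleFaces_split ht hmn F).symm,
      fun h => h.congr fun F => cycleFaces_split ht hmn F⟩
  rw [h2, h1, not_iff_not]
  have hn : n = (m + 1) * k + (r + t + 1) := by omega
  have e1 : (m + 1) * k = k * (m - 1) + 2 * k := by
    obtain ⟨l, rfl⟩ : ∃ l, m = l + 1 := ⟨m - 1, by omega⟩
    simp only [Nat.add_sub_cancel]; ring
  have e2 : cycleCodim m n = 2 * k + cycleCodim m (r + t + 1) := by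
    conv_lhs => rw [hn]
    exact cycleCodim_mul_add k _
  have e3 : n % (m + 1) = (r + t + 1) % (m + 1) := by
    conv_lhs => rw [hn]
    rw [Nat.mul_add_mod]
  rw [e3]
  by_cases h0 : r = 0
  · have h4 : cycleCodim m (r + t + 1) = 1 := cycleCodim_of_le (by omega) (by omega)
    have h5 : (r + t + 1) % (m + 1) = t + 1 := by
      rw [h0, zero_add, Nat.mod_eq_of_lt (by omega)]
    rw [h5]
    omega
  · by_cases hs : r = m - t
    · have h4 : r + t + 1 = 0 + (m + 1) := by omega
      have h5 := cycleCodim_add (m := m) 0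
      rw [← h4, show cycleCodim m 0 = 0 by simp [cycleCodim]] at h5
      have h6 : (r + t + 1) % (m + 1) = 0 := by rw [h4]; simp
      rw [h6]
      omega
    · refine iff_of_false (by omega) ?_
      rintro ⟨-, h⟩
      by_cases hlt' : r + t + 1 < m + 1
      · rw [Nat.mod_eq_of_lt hlt'] at h
        omega
      · rw [Nat.mod_eq_sub_mod (by omega), Nat.mod_eq_of_lt (by omega)] at h
        omega

/-- All strata are acyclic away from cardinality d, so the connecting maps between them cannot kill
the class of a nonacyclic stratum. -/
lemma not_isAcyclicAt_cycleFaces (hm : 1 ≤ m) (hmn : m < n) {d : ℕ}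
    (hd : d + cycleCodim m n = n) :
    ¬ IsAcyclicAt K (fun F : Finset (Fin n) => ¬ CycleGens m n F) d := by
  let Z : ℕ → Finset (Fin n) → Prop := fun t F => ¬ CycleGens m n F ∧ HasRun F (n - t) n
  have hX : ∀ t, IsConvexFamily (Z t) := fun t F G H hFG hGH h1 h2 =>
    ⟨fun h => h2.1 (isUpClosed_cycleGens m n hGH h), h1.2.mono hFG⟩
  have hW : ∀ t, ∀ ⦃F G : Finset (Fin n)⦄, F ⊆ G → Z t F → Z t G →
      HasRun F (n - (t + 1)) n → HasRun G (n - (t + 1)) n := fun t F G h _ _ h' => h'.mono h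
  have hZ : ∀ t, ∀ F, Z (t + 1) F ↔ Z t F ∧ HasRun F (n - (t + 1)) n := fun t F =>
    ⟨fun h => ⟨⟨h.1, h.2.sub (by omega) le_rfl⟩, h.2⟩, fun h => ⟨h.1.1, h.2⟩⟩
  have hsplit := fun t ht i => isAcyclicAt_cycleFaces_split (K := K) hm hmn (t := t) ht i
  have hac : ∀ j ≤ m, ∀ i, i ≠ d → IsAcyclicAt K (Z (m - j)) i := by
    intro j
    induction j with
    | zero =>
      intro _ i _
      -- A set containing the last m vertices contains a window, so this family is empty and any
      -- vertex toggles vacuously.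
      refine IsAcyclicAt.of_toggle (⟨0, by omega⟩ : Fin n) (fun F _ => iff_of_false ?_ ?_) i <;>
      · rintro ⟨h1, h2⟩
        exact h1 ⟨n - m, by omega, fun v h3 _ => h2 v h3 v.2, fun v _ _ => by omega⟩
    | succ j ih =>
      intro hj i hi
      have h := ih (by omega) i hi
      rw [show m - j = m - (j + 1) + 1 by omega] at h
      refine .of_split (hX _) (hW (m - (j + 1))) (h.congr fun F => (hZ _ F).symm) ?_
      exact (hsplit _ (by omega) i).2 (by omega)
  -- The nonacyclic stratum: t = 0 when m+1 divides n, otherwise t+1 is the remainder of n.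
  obtain ⟨t, ht, hne⟩ : ∃ t < m, ¬ IsAcyclicAt K (fun F : Finset (Fin n) =>
      (¬ CycleGens m n F ∧ HasRun F (n - t) n) ∧ ¬ HasRun F (n - (t + 1)) n) d := by
    have hlt : n % (m + 1) < m + 1 := Nat.mod_lt n m.succ_pos
    by_cases h0 : n % (m + 1) = 0
    · refine ⟨0, hm, ?_⟩
      rw [hsplit _ hm, not_not]
      exact ⟨hd, Or.inl h0⟩
    · refine ⟨n % (m + 1) - 1, by omega, ?_⟩
      rw [hsplit _ (by omega), not_not]
      exact ⟨hd, Or.inr (by omega)⟩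
  have hna : ∀ j ≤ t, ¬ IsAcyclicAt K (Z (t - j)) d := by
    intro j
    induction j with
    | zero =>
      intro _ h
      have h1 := hac (m - (t + 1)) (by omega) (d + 1) (by omega)
      rw [show m - (m - (t + 1)) = t + 1 by omega] at h1
      exact hne (h.lower (hX t) (hW t) (h1.congr fun F => (hZ _ F).symm))
    | succ j ih =>
      intro hj h
      refine ih (by omega) ?_
      rw [show t - j = t - (j + 1) + 1 by omega]
      refine (h.upper (hX _) (hW _) ?_).congr (hZ _)
      rcases Nat.eq_zero_or_pos d with h0 | h0
      · exact Or.inl h0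
      · exact Or.inr ((hsplit _ (by omega) _).2 (by omega))
  refine fun h => hna t le_rfl (h.congr fun F => ?_)
  rw [Nat.sub_self]
  exact ⟨fun h => h.1, fun h => ⟨h, fun v h1 _ => by omega⟩⟩

end CycleCohomology

/-! ### Depth of the path ideal -/

section Depth

variable {K : Type*} [Field K] {n m : ℕ}

open RingTheory.Sequence in
lemma gradedDepth_eq_of_koszulExact {J : Ideal (MvPolynomial (Fin n) K)} (hJ : J ≠ ⊥) {d : ℕ}
    (h : ∀ i < d, KoszulExact (X : Fin n → MvPolynomial (Fin n) K) J i)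
    (hd : ¬ KoszulExact (X : Fin n → MvPolynomial (Fin n) K) J d) :
    gradedDepth K (Fin n) J = d := by
  refine IsGreatest.csSup_eq ⟨?_, ?_⟩
  · obtain ⟨rs, h1, h2, h3⟩ := exists_isWeaklyRegular_of_koszulExact d h
    refine ⟨rs, h1, h2, h3, fun htop => hJ ?_⟩
    have hle : Ideal.ofList rs ≤ Ideal.span (Set.range (X : Fin n → MvPolynomial (Fin n) K)) :=
      Ideal.span_le.2 h2
    -- Nakayama's lemma turns weak regularity into regularity: an r congruent to 1 modulo the
    -- variables would annihilate the nonzero ideal J inside a domain.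
    obtain ⟨r, hr, hr'⟩ := Submodule.exists_sub_one_mem_and_smul_eq_zero_of_fg_of_le_smul
      (Ideal.ofList rs) (⊤ : Submodule (MvPolynomial (Fin n) K) J) (Module.Finite.fg_top) htop.le
    have hr0 : r ≠ 0 := by
      rintro rfl
      have h4 := hle hr
      have h5 : Ideal.span (Set.range (X : Fin n → MvPolynomial (Fin n) K)) ≤
          RingHom.ker (constantCoeff (R := K) (σ := Fin n)) := by
        rw [Ideal.span_le]
        rintro _ ⟨j, rfl⟩
        simp [RingHom.mem_ker]
      have h6 := h5 h4
      simp [RingHom.mem_ker] at h6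
    rw [eq_bot_iff]
    intro p hp
    have := congrArg Subtype.val (hr' ⟨p, hp⟩ trivial)
    simp only [Submodule.coe_smul, smul_eq_mul, Submodule.coe_zero, mul_eq_zero] at this
    exact this.resolve_left hr0
  · rintro e ⟨rs, rfl, h2, h3⟩
    by_contra hlt
    exact hd (KoszulExact.of_isWeaklyRegular rs h2 h3.toIsWeaklyRegular d (by omega))

lemma cycleGens_univ (hmn : m < n) : CycleGens m n (Finset.univ : Finset (Fin n)) :=
  ⟨0, by omega, fun v _ _ => Finset.mem_univ v, fun v _ _ => Finset.mem_univ v⟩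

lemma sqfreeIdeal_ne_bot {U : Finset (Fin n) → Prop} (hU : U Finset.univ) :
    sqfreeIdeal K U ≠ ⊥ := by
  intro h
  have h1 := monomial_mem_sqfreeIdeal (K := K) (U := U) (s := sqfreeExp Finset.univ)
    (by rwa [support_sqfreeExp])
  rw [h, Ideal.mem_bot, monomial_eq_zero] at h1
  exact one_ne_zero h1

/-- The Koszul cohomology of S/J first appears in degree d = n − c(n); as that of S vanishes below
n, the cohomology of J first appears in degree d+1. -/
lemma gradedDepth_sqfreeIdeal_cycleGens (hm : 1 ≤ m) (hmn : m < n) :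
    gradedDepth K (Fin n) (sqfreeIdeal K (CycleGens (n := n) m n)) + cycleCodim m n = n + 1 := by
  set J := sqfreeIdeal K (CycleGens (n := n) m n) with hJdef
  have hpos : 1 ≤ cycleCodim m n := cycleCodim_pos (by omega)
  obtain ⟨d, hd⟩ : ∃ d, d + cycleCodim m n = n := by
    -- The bound c(n) ≤ n holds since c(n) is twice the quotient of n by m+1 ≥ 2, plus one when the
    -- remainder is nonzero.
    refine ⟨n - cycleCodim m n, Nat.sub_add_cancel ?_⟩
    have hdm := Nat.div_add_mod n (m + 1)
    have hlt : n % (m + 1) < m + 1 := Nat.mod_lt n m.succ_pos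
    have h1 : n / (m + 1) * 2 ≤ (m + 1) * (n / (m + 1)) := by
      rw [mul_comm]; exact Nat.mul_le_mul_right _ (by omega)
    rw [← hdm, cycleCodim_mul_add]
    rcases Nat.eq_zero_or_pos (n % (m + 1)) with h0 | h0
    · have hz : cycleCodim m 0 = 0 := by simp [cycleCodim]
      rw [h0, hz]; omega
    · rw [cycleCodim_of_le h0 (by omega)]; omega
  have hS : ∀ i < n, KoszulExact (X : Fin n → MvPolynomial (Fin n) K)
      (MvPolynomial (Fin n) K) i := fun i hi => koszulExact_polynomial hi
  have hinj : Function.Injective J.subtype := Subtype.val_injective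
  have hex : ∀ y, J.mkQ y = 0 → ∃ z, J.subtype z = y := fun y hy =>
    ⟨⟨y, (Submodule.Quotient.mk_eq_zero _).1 hy⟩, rfl⟩
  have hex' : ∀ z, J.mkQ (J.subtype z) = 0 := fun z =>
    (Submodule.Quotient.mk_eq_zero _).2 z.2
  have h := gradedDepth_eq_of_koszulExact (K := K) (J := J) (d := d + 1)
    (sqfreeIdeal_ne_bot (cycleGens_univ hmn)) ?_ ?_
  · rw [h]; omega
  · intro i hi
    cases i with
    | zero => exact KoszulExact.of_injective hinj (hS 0 (by omega))
    | succ i =>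
      exact KoszulExact.left hinj (Submodule.mkQ_surjective J) hex hex' (hS _ (by omega))
        (hasPdLE_cycleGens hm hmn i (by omega))
  · intro h
    refine not_isAcyclicAt_cycleFaces (K := K) hm hmn hd ?_
    exact (KoszulExact.right hinj (Submodule.mkQ_surjective J) hex hex' (hS d (by omega))
      h).isAcyclicAt (isUpClosed_cycleGens m n)

end Depth

/-! ### Operations on interval partitions -/

section IntervalPartitions

variable {α β ι : Type*}

/-- The family `𝓕` of subsets of `V` is a disjoint union of intervals `[A, B]` with
`|V \ B| ≤ κ`. -/
def HasIntervalPartition (V : Finset α) (𝓕 : Finset α → Prop) (κ : ℕ) : Prop :=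
  ∃ C : Finset (Finset α × Finset α),
    (∀ c ∈ C, c.1 ⊆ c.2 ∧ c.2 ⊆ V ∧ V.card ≤ c.2.card + κ) ∧
    (∀ F, 𝓕 F ↔ ∃ c ∈ C, c.1 ⊆ F ∧ F ⊆ c.2) ∧
    ∀ F, ∀ c ∈ C, ∀ c' ∈ C, c.1 ⊆ F → F ⊆ c.2 → c'.1 ⊆ F → F ⊆ c'.2 → c = c'

namespace HasIntervalPartition

variable {V : Finset α} {𝓕 𝓖 : Finset α → Prop} {κ : ℕ}

lemma congr (h : HasIntervalPartition V 𝓕 κ) (h' : ∀ F, 𝓖 F ↔ 𝓕 F) :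
    HasIntervalPartition V 𝓖 κ := by
  obtain rfl : 𝓖 = 𝓕 := funext fun F => propext (h' F)
  exact h

lemma mono (h : HasIntervalPartition V 𝓕 κ) {κ' : ℕ} (h' : κ ≤ κ') :
    HasIntervalPartition V 𝓕 κ' := by
  obtain ⟨C, h1, h2⟩ := h
  exact ⟨C, fun c hc => ⟨(h1 c hc).1, (h1 c hc).2.1, (h1 c hc).2.2.trans (by omega)⟩, h2⟩

lemma of_false (h : ∀ F, ¬ 𝓕 F) : HasIntervalPartition V 𝓕 κ :=
  ⟨∅, by simp, fun F => by simp [h F], by simp⟩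

lemma interval {A B : Finset α} (hAB : A ⊆ B) (hB : B ⊆ V) (h : V.card ≤ B.card + κ) :
    HasIntervalPartition V (fun F => A ⊆ F ∧ F ⊆ B) κ :=
  ⟨{(A, B)}, by simp [hAB, hB, h], by simp, by
    simp only [Finset.mem_singleton]; rintro F c rfl c' rfl _ _ _ _; rfl⟩

lemma image [DecidableEq β] (h : HasIntervalPartition V 𝓕 κ) {f : α → β} (hf : Set.InjOn f V) :
    HasIntervalPartition (V.image f)
      (fun F => F ⊆ V.image f ∧ 𝓕 (V.filter fun v => f v ∈ F)) κ := by
  obtain ⟨C, h1, h2, h3⟩ := h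
  have key : ∀ c ∈ C, ∀ F, c.1.image f ⊆ F ∧ F ⊆ c.2.image f ↔ F ⊆ V.image f ∧
      (c.1 ⊆ (V.filter fun v => f v ∈ F) ∧ (V.filter fun v => f v ∈ F) ⊆ c.2) := by
    intro c hc F
    obtain ⟨h4, h5, -⟩ := h1 c hc
    constructor
    · rintro ⟨h6, h7⟩
      refine ⟨h7.trans (Finset.image_subset_image h5), fun v hv => ?_, fun v hv => ?_⟩
      · exact Finset.mem_filter.2 ⟨h5 (h4 hv), h6 (Finset.mem_image_of_mem f hv)⟩
      · rw [Finset.mem_filter] at hv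
        obtain ⟨w, hw, hwv⟩ := Finset.mem_image.1 (h7 hv.2)
        rwa [← hf (h5 hw) hv.1 hwv]
    · rintro ⟨h6, h7, h8⟩
      refine ⟨fun v hv => ?_, fun v hv => ?_⟩
      · obtain ⟨w, hw, rfl⟩ := Finset.mem_image.1 hv
        exact (Finset.mem_filter.1 (h7 hw)).2
      · obtain ⟨w, hw, rfl⟩ := Finset.mem_image.1 (h6 hv)
        exact Finset.mem_image_of_mem f (h8 (Finset.mem_filter.2 ⟨hw, hv⟩))
  refine ⟨C.image fun c => (c.1.image f, c.2.image f), fun c hc₀ => ?_, fun F => ?_,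
    fun F c hc₀ c' hc₀' a b a' b' => ?_⟩
  · obtain ⟨c, hc, rfl⟩ := Finset.mem_image.1 hc₀
    obtain ⟨h4, h5, h6⟩ := h1 c hc
    refine ⟨Finset.image_subset_image h4, Finset.image_subset_image h5, ?_⟩
    rwa [Finset.card_image_of_injOn hf,
      Finset.card_image_of_injOn (hf.mono (Finset.coe_subset.2 h5))]
  · simp only [h2, Finset.exists_mem_image]
    constructor
    · rintro ⟨h5, c, hc, h4⟩
      exact ⟨c, hc, (key c hc F).2 ⟨h5, h4⟩⟩
    · rintro ⟨c, hc, h4⟩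
      have := (key c hc F).1 h4
      exact ⟨this.1, c, hc, this.2⟩
  · obtain ⟨c, hc, rfl⟩ := Finset.mem_image.1 hc₀
    obtain ⟨c', hc', rfl⟩ := Finset.mem_image.1 hc₀'
    have h4 := ((key c hc F).1 ⟨a, b⟩).2
    have h5 := ((key c' hc' F).1 ⟨a', b'⟩).2
    rw [h3 _ c hc c' hc' h4.1 h4.2 h5.1 h5.2]

variable [DecidableEq α]

lemma or (h : HasIntervalPartition V 𝓕 κ) (h' : HasIntervalPartition V 𝓖 κ)
    (hd : ∀ F, 𝓕 F → ¬ 𝓖 F) : HasIntervalPartition V (fun F => 𝓕 F ∨ 𝓖 F) κ := by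
  obtain ⟨C, h1, h2, h3⟩ := h
  obtain ⟨C', h1', h2', h3'⟩ := h'
  refine ⟨C ∪ C', fun c hc => ?_, fun F => ?_, fun F c hc c' hc' a b a' b' => ?_⟩
  · rcases Finset.mem_union.1 hc with hc | hc
    · exact h1 c hc
    · exact h1' c hc
  · simp only [h2, h2', Finset.mem_union, or_and_right, exists_or]
  · rcases Finset.mem_union.1 hc with hc | hc <;> rcases Finset.mem_union.1 hc' with hc' | hc'
    · exact h3 F c hc c' hc' a b a' b'
    · exact absurd ((h2' F).2 ⟨c', hc', a', b'⟩) (hd F ((h2 F).2 ⟨c, hc, a, b⟩))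
    · exact absurd ((h2' F).2 ⟨c, hc, a, b⟩) (hd F ((h2 F).2 ⟨c', hc', a', b'⟩))
    · exact h3' F c hc c' hc' a b a' b'

lemma exists_mem [DecidableEq ι] (s : Finset ι) {𝓕 : ι → Finset α → Prop}
    (h : ∀ i ∈ s, HasIntervalPartition V (𝓕 i) κ)
    (hd : ∀ i j F, 𝓕 i F → 𝓕 j F → i = j) :
    HasIntervalPartition V (fun F => ∃ i ∈ s, 𝓕 i F) κ := by
  induction s using Finset.induction_on with
  | empty => exact of_false (by simp)
  | insert i s hi ih =>
    refine ((h i (Finset.mem_insert_self i s)).or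
      (ih fun j hj => h j (Finset.mem_insert_of_mem hj)) ?_).congr (by simp)
    rintro F h1 ⟨j, hj, h2⟩
    exact hi (hd i j F h1 h2 ▸ hj)

/-- Product with an interval `[A, B]` of subsets of a disjoint set `V'`. -/
lemma extend (h : HasIntervalPartition V 𝓕 κ) {V' A B : Finset α} (hV : Disjoint V V')
    (hAB : A ⊆ B) (hB : B ⊆ V') {κ' : ℕ} (hκ : V'.card + κ ≤ B.card + κ') :
    HasIntervalPartition (V ∪ V') (fun F => 𝓕 (F ∩ V) ∧ A ⊆ F ∧ F ⊆ V ∪ B) κ' := by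
  obtain ⟨C, h1, h2, h3⟩ := h
  have hVB : Disjoint V B := hV.mono_right hB
  have key : ∀ c ∈ C, ∀ F, c.1 ∪ A ⊆ F ∧ F ⊆ c.2 ∪ B ↔
      (c.1 ⊆ F ∩ V ∧ F ∩ V ⊆ c.2) ∧ A ⊆ F ∧ F ⊆ V ∪ B := by
    intro c hc F
    obtain ⟨h4, h5, -⟩ := h1 c hc
    constructor
    · rintro ⟨h6, h7⟩
      refine ⟨⟨fun v hv => Finset.mem_inter.2 ⟨h6 (Finset.mem_union_left _ hv), h5 (h4 hv)⟩,
        fun v hv => ?_⟩, fun v hv => h6 (Finset.mem_union_right _ hv),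
        h7.trans (Finset.union_subset_union_left h5)⟩
      rw [Finset.mem_inter] at hv
      exact (Finset.mem_union.1 (h7 hv.1)).resolve_right (Finset.disjoint_left.1 hVB hv.2)
    · rintro ⟨⟨h6, h7⟩, h8, h9⟩
      refine ⟨Finset.union_subset (h6.trans Finset.inter_subset_left) h8, fun v hv => ?_⟩
      rcases Finset.mem_union.1 (h9 hv) with h | h
      · exact Finset.mem_union_left _ (h7 (Finset.mem_inter.2 ⟨hv, h⟩))
      · exact Finset.mem_union_right _ h
  refine ⟨C.image fun c => (c.1 ∪ A, c.2 ∪ B), fun c hc₀ => ?_, fun F => ?_,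
    fun F c hc₀ c' hc₀' a b a' b' => ?_⟩
  · obtain ⟨c, hc, rfl⟩ := Finset.mem_image.1 hc₀
    obtain ⟨h4, h5, h6⟩ := h1 c hc
    refine ⟨Finset.union_subset_union h4 hAB, Finset.union_subset_union h5 hB, ?_⟩
    rw [Finset.card_union_of_disjoint hV, Finset.card_union_of_disjoint (hVB.mono_left h5)]
    omega
  · simp only [h2, Finset.exists_mem_image]
    constructor
    · rintro ⟨⟨c, hc, h4⟩, h5⟩
      exact ⟨c, hc, (key c hc F).2 ⟨h4, h5⟩⟩
    · rintro ⟨c, hc, h4⟩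
      have := (key c hc F).1 h4
      exact ⟨⟨c, hc, this.1⟩, this.2⟩
  · obtain ⟨c, hc, rfl⟩ := Finset.mem_image.1 hc₀
    obtain ⟨c', hc', rfl⟩ := Finset.mem_image.1 hc₀'
    have h4 := ((key c hc F).1 ⟨a, b⟩).1
    have h5 := ((key c' hc' F).1 ⟨a', b'⟩).1
    rw [h3 _ c hc c' hc' h4.1 h4.2 h5.1 h5.2]

end HasIntervalPartition

end IntervalPartitions

/-! ### Interval partitions for paths -/

section PathPartitions

open Finset

/-- The sets of vertices of the path on `b ≤ v < N` containing neither the initial segment of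
length `s` nor `m` consecutive vertices other than `b`. -/
def PathSets (m b s N : ℕ) (F : Finset ℕ) : Prop :=
  F ⊆ Ico b N ∧ ¬ ((b + s ≤ N ∧ Ico b (b + s) ⊆ F) ∨
    ∃ j, b + 1 ≤ j ∧ j + m ≤ N ∧ Ico j (j + m) ⊆ F)

variable {m : ℕ}

lemma hasIntervalPartition_pathSets_of_lt {b s N : ℕ} (hsm : s ≤ m) (h : N < b + s) (κ : ℕ) :
    HasIntervalPartition (Ico b N) (PathSets m b s N) κ := by
  refine (HasIntervalPartition.interval (empty_subset (Ico b N)) subset_rfl (by omega)).congr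
    fun F => ?_
  refine ⟨fun h => ⟨empty_subset _, h.1⟩, fun h' => ⟨h'.2, ?_⟩⟩
  rintro (⟨h1, -⟩ | ⟨j, h1, h2, -⟩) <;> omega

/-- Same dichotomy as in cohomology, with segment length s+1. If the s vertices after b are not all
in F, then b is free; otherwise they are forced in, b is forced out, and only b counts against the
upper end of the interval. -/
lemma HasIntervalPartition.pathSets_step {b s N κ : ℕ} (hsm : s + 1 ≤ m) (hsN : b + (s + 1) ≤ N)
    (h1 : HasIntervalPartition (Ico (b + 1) N) (PathSets m (b + 1) s N) (κ + 1))
    (h2 : HasIntervalPartition (Ico (b + (s + 1)) N)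
      (PathSets m (b + (s + 1)) (m + 1 - (s + 1)) N) κ) :
    HasIntervalPartition (Ico b N) (PathSets m b (s + 1) N) (κ + 1) := by
  have e1 : Ico (b + 1) N ∪ {b} = Ico b N := by ext x; simp; omega
  have e2 : Ico (b + (s + 1)) N ∪ Ico b (b + (s + 1)) = Ico b N := by ext x; simp; omega
  have h1' := h1.extend (V' := {b}) (A := ∅) (B := {b}) (κ' := κ + 1) (by simp)
    (empty_subset _) subset_rfl le_rfl
  have h2' := h2.extend (V' := Ico b (b + (s + 1))) (A := Ico (b + 1) (b + (s + 1)))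
    (B := Ico (b + 1) (b + (s + 1))) (κ' := κ + 1)
    (disjoint_left.2 fun x hx hx' => by simp at hx hx'; omega) subset_rfl
    (Ico_subset_Ico_left (by omega)) (by simp; omega)
  rw [e1] at h1'
  rw [e2] at h2'
  refine (h1'.or h2' ?_).congr ?_
  · rintro F ⟨⟨-, h3⟩, -⟩ ⟨-, h4, -⟩
    refine h3 (Or.inl ⟨by omega, fun x hx => ?_⟩)
    rw [mem_Ico] at hx
    exact mem_inter.2 ⟨h4 (mem_Ico.2 ⟨by omega, by omega⟩), mem_Ico.2 ⟨by omega, by omega⟩⟩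
  · intro F
    constructor
    · rintro ⟨h3, h4⟩
      by_cases hw : Ico (b + 1) (b + (s + 1)) ⊆ F
      · right
        have hb : b ∉ F := fun hb => h4 (Or.inl ⟨hsN, fun x hx => by
          rw [mem_Ico] at hx
          by_cases hxb : x = b
          · rwa [hxb]
          · exact hw (mem_Ico.2 ⟨by omega, by omega⟩)⟩)
        refine ⟨⟨inter_subset_right, ?_⟩, hw, fun x hx => ?_⟩
        · rintro (⟨h5, h6⟩ | ⟨j, h5, h6, h7⟩)
          · refine h4 (Or.inr ⟨b + 1, le_rfl, by omega, fun x hx => ?_⟩)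
            rw [mem_Ico] at hx
            by_cases hxs : x < b + (s + 1)
            · exact hw (mem_Ico.2 ⟨by omega, hxs⟩)
            · exact (mem_inter.1 (h6 (mem_Ico.2 ⟨by omega, by omega⟩))).1
          · exact h4 (Or.inr ⟨j, by omega, h6, h7.trans inter_subset_left⟩)
        · have := mem_Ico.1 (h3 hx)
          have hxb : x ≠ b := by rintro rfl; exact hb hx
          rw [mem_union, mem_Ico, mem_Ico]
          omega
      · left
        refine ⟨⟨inter_subset_right, ?_⟩, empty_subset _, h3⟩
        rintro (⟨h5, h6⟩ | ⟨j, h5, h6, h7⟩)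
        · refine hw fun x hx => ?_
          rw [mem_Ico] at hx
          exact (mem_inter.1 (h6 (mem_Ico.2 ⟨by omega, by omega⟩))).1
        · exact h4 (Or.inr ⟨j, by omega, h6, h7.trans inter_subset_left⟩)
    · rintro (⟨⟨-, h3⟩, -, h4⟩ | ⟨⟨-, h3⟩, h4, h5⟩)
      · have hw : ¬ Ico (b + 1) (b + (s + 1)) ⊆ F :=
          fun hw => h3 (Or.inl ⟨by omega, fun x hx => by
          rw [mem_Ico] at hx
          exact mem_inter.2 ⟨hw (mem_Ico.2 ⟨by omega, by omega⟩),
            mem_Ico.2 ⟨by omega, by omega⟩⟩⟩)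
        refine ⟨h4, ?_⟩
        rintro (⟨h5, h6⟩ | ⟨j, h5, h6, h7⟩)
        · exact hw ((Ico_subset_Ico_left (by omega)).trans h6)
        · by_cases hj : b + 1 + 1 ≤ j
          · refine h3 (Or.inr ⟨j, hj, h6, fun x hx => ?_⟩)
            have := mem_Ico.1 hx
            exact mem_inter.2 ⟨h7 hx, mem_Ico.2 ⟨by omega, by omega⟩⟩
          · exact hw ((Ico_subset_Ico (by omega) (by omega)).trans h7)
      · refine ⟨fun x hx => ?_, ?_⟩
        · have := h5 hx
          rw [mem_union, mem_Ico, mem_Ico] at this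
          rw [mem_Ico]; omega
        · rintro (⟨h6, h7⟩ | ⟨j, h6, h7, h8⟩)
          · have := h5 (h7 (mem_Ico.2 ⟨le_rfl, by omega⟩))
            rw [mem_union, mem_Ico, mem_Ico] at this
            omega
          · by_cases hj : b + (s + 1) + 1 ≤ j
            · refine h3 (Or.inr ⟨j, hj, h7, fun x hx => ?_⟩)
              have := mem_Ico.1 hx
              exact mem_inter.2 ⟨h8 hx, mem_Ico.2 ⟨by omega, by omega⟩⟩
            · refine h3 (Or.inl ⟨by omega, fun x hx => ?_⟩)
              rw [mem_Ico] at hx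
              exact mem_inter.2 ⟨h8 (mem_Ico.2 ⟨by omega, by omega⟩),
                mem_Ico.2 ⟨by omega, by omega⟩⟩

/-- Classifies sets by the last vertex of [b, b+s) that they omit: earlier vertices are free, later
ones are forced. If l ≤ s−1 vertices follow it, the remaining path must avoid an initial segment of
length t = m−l, hence the range of t. -/
lemma HasIntervalPartition.pathSets_succ {N κ : ℕ} (s : ℕ) : ∀ {b : ℕ}, s ≤ m → b + s ≤ N →
    (∀ t, m + 1 - s ≤ t → t ≤ m →
      HasIntervalPartition (Ico (b + s) N) (PathSets m (b + s) t N) κ) →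
    HasIntervalPartition (Ico b N) (PathSets m b s N) (κ + 1) := by
  induction s with
  | zero =>
    intro b _ hb _
    -- An initial segment of length 0 is contained in every set, so the family is empty.
    exact .of_false fun F h => h.2 (Or.inl ⟨hb, by simp⟩)
  | succ s ih =>
    intro b hs hb h
    refine .pathSets_step hs hb (ih (by omega) (by omega) fun t ht htm => ?_)
      (h _ le_rfl (by omega))
    rw [show b + 1 + s = b + (s + 1) by ring]
    exact h t (by omega) htm

/-- Each omitted vertex costs 1. Two rounds pass over s+t ≥ m+1 vertices, against an increase of c
by 2. For s = m a single round suffices, because p(L) = c(L−m) + 1 when L ≥ m. -/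
lemma hasIntervalPartition_pathSets (L : ℕ) : ∀ {b s : ℕ}, 1 ≤ s → s ≤ m →
    HasIntervalPartition (Ico b (b + L)) (PathSets m b s (b + L)) (cycleCodim m L) ∧
    HasIntervalPartition (Ico b (b + L)) (PathSets m b m (b + L)) (pathCodim m L) := by
  induction L using Nat.strong_induction_on with
  | _ L ih =>
  intro b s hs hsm
  have ihc : ∀ L' < L, ∀ b' s', b' + L' = b + L → 1 ≤ s' → s' ≤ m →
      HasIntervalPartition (Ico b' (b + L)) (PathSets m b' s' (b + L)) (cycleCodim m L') := by
    intro L' hL b' s' hb h1 h2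
    rw [← hb]; exact (ih L' hL h1 h2).1
  constructor
  · by_cases hL : L < s
    · exact hasIntervalPartition_pathSets_of_lt hsm (by omega) _
    have e1 := cycleCodim_pos (m := m) (N := L) (by omega)
    rw [← Nat.sub_add_cancel e1]
    refine .pathSets_succ s hsm (by omega) fun t ht htm => ?_
    by_cases hL' : L < s + t
    · exact hasIntervalPartition_pathSets_of_lt htm (by omega) _
    have e2 := cycleCodim_add (m := m) (L - (m + 1))
    rw [Nat.sub_add_cancel (by omega)] at e2
    rw [show cycleCodim m L - 1 = cycleCodim m (L - (m + 1)) + 1 by omega]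
    refine .pathSets_succ t htm (by omega) fun u hu hum => ?_
    exact (ihc (L - s - t) (by omega) _ u (by omega) (by omega) hum).mono
      (cycleCodim_mono (by omega))
  · by_cases hL : L < m
    · exact hasIntervalPartition_pathSets_of_lt le_rfl (by omega) _
    have e1 := cycleCodim_succ (m := m) L
    have e2 := cycleCodim_add (m := m) (L - m)
    rw [show L - m + (m + 1) = L + 1 by omega] at e2
    rw [show pathCodim m L = cycleCodim m (L - m) + 1 by omega]
    refine .pathSets_succ m le_rfl (by omega) fun t ht htm => ?_
    exact ihc (L - m) (by omega) _ t (by omega) (by omega) htm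

/-- The sets of vertices of the path on `b ≤ v < N` in which at most the run starting with `b` has
`m` or more elements. -/
def InitialRunSets (m b N : ℕ) (F : Finset ℕ) : Prop :=
  F ⊆ Ico b N ∧ ∀ j, b + 1 ≤ j → j + m ≤ N → Ico j (j + m) ⊆ F → j - 1 ∈ F

/-- Either the first m vertices are not all present, and no window occurs at all; or they are, and
the same problem recurs behind them, since a run beginning there merely continues the initial one.
Forced vertices cost nothing. -/
lemma hasIntervalPartition_initialRunSets (hm : 1 ≤ m) (L : ℕ) : ∀ b : ℕ,
    HasIntervalPartition (Ico b (b + L)) (InitialRunSets m b (b + L)) (pathCodim m L) := by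
  induction L using Nat.strong_induction_on with
  | _ L ih =>
  intro b
  by_cases hL : L < m
  · refine (HasIntervalPartition.interval (empty_subset (Ico b (b + L))) subset_rfl
      (by omega)).congr fun F => ?_
    refine ⟨fun h => ⟨empty_subset _, h.1⟩, fun h' => ⟨h'.2, fun j h1 h2 => ?_⟩⟩
    omega
  have h1 := (hasIntervalPartition_pathSets (m := m) L (b := b) hm le_rfl).2
  have h2 := ih (L - m) (by omega) (b + m)
  rw [show b + m + (L - m) = b + L by omega] at h2
  have h2' := (h2.mono (pathCodim_mono (Nat.sub_le L m))).extend (V' := Ico b (b + m))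
    (A := Ico b (b + m)) (B := Ico b (b + m)) (κ' := pathCodim m L)
    (disjoint_left.2 fun x hx hx' => by simp at hx hx'; omega) subset_rfl subset_rfl le_rfl
  have e2 : Ico (b + m) (b + L) ∪ Ico b (b + m) = Ico b (b + L) := by ext x; simp; omega
  rw [e2] at h2'
  refine (h1.or h2' ?_).congr fun F => ?_
  · rintro F ⟨-, h3⟩ ⟨-, h4, -⟩
    exact h3 (Or.inl ⟨by omega, h4⟩)
  · constructor
    · rintro ⟨h3, h4⟩
      by_cases hw : Ico b (b + m) ⊆ F
      · refine Or.inr ⟨⟨inter_subset_right, fun j h5 h6 h7 => ?_⟩, hw, h3⟩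
        exact mem_inter.2 ⟨h4 j (by omega) h6 (h7.trans inter_subset_left),
          mem_Ico.2 ⟨by omega, by omega⟩⟩
      · refine Or.inl ⟨h3, ?_⟩
        -- A window inside F could be moved back one vertex at a time down to b.
        have hno : ∀ i, b + i + m ≤ b + L → ¬ Ico (b + i) (b + i + m) ⊆ F := by
          intro i
          induction i with
          | zero => intro _; exact hw
          | succ i ih =>
            intro h5 h6
            refine ih (by omega) fun x hx => ?_
            rw [mem_Ico] at hx
            by_cases hxi : x = b + i
            · have := h4 (b + (i + 1)) (by omega) (by omega) h6
              rwa [hxi]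
            · exact h6 (mem_Ico.2 ⟨by omega, by omega⟩)
        rintro (⟨-, h5⟩ | ⟨j, h5, h6, h7⟩)
        · exact hw h5
        · obtain ⟨i, rfl⟩ := Nat.exists_eq_add_of_le (show b ≤ j by omega)
          exact hno i h6 h7
    · rintro (⟨h3, h4⟩ | ⟨⟨-, h3⟩, h4, h5⟩)
      · exact ⟨h3, fun j h5 h6 h7 => absurd (Or.inr ⟨j, h5, h6, h7⟩) h4⟩
      · refine ⟨h5, fun j h6 h7 h8 => ?_⟩
        by_cases hj : b + m + 1 ≤ j
        · refine (mem_inter.1 (h3 j hj h7 fun x hx => ?_)).1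
          have := mem_Ico.1 hx
          exact mem_inter.2 ⟨h8 hx, mem_Ico.2 ⟨by omega, by omega⟩⟩
        · exact h4 (mem_Ico.2 ⟨by omega, by omega⟩)

end PathPartitions

/-! ### Interval partition for the cycle -/

section CyclePartition

open Finset

variable {n m : ℕ}

lemma cycleStep_congr {a : Fin n} {k l : ℕ} (h : (a.val + k) % n = (a.val + l) % n) :
    cycleStep a k = cycleStep a l := Fin.ext h

lemma cycleStep_cycleStep (a : Fin n) (k l : ℕ) :
    cycleStep (cycleStep a k) l = cycleStep a (k + l) := by
  apply Fin.ext
  simp only [cycleStep]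
  rw [Nat.mod_add_mod, add_assoc]

lemma cycleStep_add_self (a : Fin n) (k : ℕ) : cycleStep a (k + n) = cycleStep a k :=
  cycleStep_congr (by rw [← add_assoc, Nat.add_mod_right])

lemma injOn_cycleStep (a : Fin n) : Set.InjOn (cycleStep a) (range n : Finset ℕ) := by
  intro k hk l hl h
  simp only [coe_range, Set.mem_Iio] at hk hl
  have h1 : (a.val + k) % n = (a.val + l) % n := congrArg Fin.val h
  exact Nat.ModEq.eq_of_lt_of_lt (Nat.ModEq.add_left_cancel' a.val h1) hk hl

lemma image_cycleStep (a : Fin n) : (range n).image (cycleStep a) = univ := by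
  rw [← Finset.card_eq_iff_eq_univ, card_image_of_injOn (injOn_cycleStep a), card_range,
    Fintype.card_fin]

/-- `F` contains a run of at least `m` vertices of the cycle, starting with `a`. -/
def IsRunStart (m : ℕ) (F : Finset (Fin n)) (a : Fin n) : Prop :=
  (∀ k < m, cycleStep a k ∈ F) ∧ cycleStep a (n - 1) ∉ F

/-- Sets whose last run of at least `m` vertices starts with `a`. -/
def IsLastRunStart (m : ℕ) (F : Finset (Fin n)) (a : Fin n) : Prop :=
  IsRunStart m F a ∧ ∀ a', a < a' → ¬ IsRunStart m F a'

lemma exists_isRunStart {F : Finset (Fin n)} (hF : F ≠ univ) {a : Fin n}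
    (ha : ∀ k < m, cycleStep a k ∈ F) : ∃ a', IsRunStart m F a' := by
  have hne : ((range n).filter fun k => cycleStep a k ∉ F).Nonempty := by
    by_contra h
    refine hF (eq_univ_iff_forall.2 fun v => ?_)
    have hv : v ∈ (range n).image (cycleStep a) := by rw [image_cycleStep]; exact mem_univ v
    obtain ⟨k, hk, rfl⟩ := mem_image.1 hv
    by_contra hkF
    exact h ⟨k, mem_filter.2 ⟨hk, hkF⟩⟩
  obtain ⟨hk, hmax⟩ := ((range n).filter fun k => cycleStep a k ∉ F).isGreatest_max' hne
  set k := ((range n).filter fun k => cycleStep a k ∉ F).max' hne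
  simp only [coe_filter, mem_range, Set.mem_ofPred_eq] at hk
  have hup : ∀ i, k < i → i < n → cycleStep a i ∈ F := by
    intro i hi hin
    by_contra h
    have := hmax (show i ∈ _ from by simpa using ⟨hin, h⟩)
    omega
  -- Here k is the position of the last omitted vertex met when going once around from a; the run
  -- behind it leads into the given window, so it has at least m vertices.
  refine ⟨cycleStep a (k + 1), fun i hi => ?_, ?_⟩
  · rw [cycleStep_cycleStep]
    by_cases h : k + 1 + i < n
    · exact hup _ (by omega) h
    · rw [show k + 1 + i = (k + 1 + i - n) + n by omega, cycleStep_add_self]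
      exact ha _ (by omega)
  · rw [cycleStep_cycleStep, show k + 1 + (n - 1) = k + n by omega, cycleStep_add_self]
    exact hk.2

lemma exists_isLastRunStart {F : Finset (Fin n)} {a : Fin n} (ha : IsRunStart m F a) :
    ∃ a', IsLastRunStart m F a' := by
  classical
  have hne : (univ.filter (IsRunStart m F)).Nonempty := ⟨a, by simpa using ha⟩
  obtain ⟨h1, h2⟩ := (univ.filter (IsRunStart m F)).isGreatest_max' hne
  refine ⟨_, by simpa using h1, fun a' h3 h4 => absurd (h2 ?_) (not_le.2 h3)⟩
  simpa using h4

lemma IsLastRunStart.eq {F : Finset (Fin n)} {a a' : Fin n} (h : IsLastRunStart m F a)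
    (h' : IsLastRunStart m F a') : a = a' := by
  rcases lt_trichotomy a a' with hlt | heq | hlt
  · exact absurd h'.1 (h.2 a' hlt)
  · exact heq
  · exact absurd h.1 (h'.2 a hlt)

/-- In positions counted from a, the first m are present and n−1 is absent. A run starting at a
larger label has position j ≤ n−1−a, and j + m ≤ n−1 because it avoids position n−1. With this L
both conditions together say that the window lies below m+L, so the positions from m+L to n−2 are
unconstrained. -/
lemma isLastRunStart_iff (hmn : m < n) (a : Fin n) {L : ℕ} (hL : L = min (n - 1 - a) (n - 1 - m))
    (F : Finset (Fin n)) :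
    IsLastRunStart m F a ↔
      InitialRunSets m m (m + L) (((range n).filter fun k => cycleStep a k ∈ F) ∩ Ico m (m + L)) ∧
      Ico 0 m ⊆ ((range n).filter fun k => cycleStep a k ∈ F) ∧
      ((range n).filter fun k => cycleStep a k ∈ F) ⊆
        Ico m (m + L) ∪ (Ico 0 m ∪ Ico (m + L) (n - 1)) := by
  have ha := a.2
  set G := (range n).filter fun k => cycleStep a k ∈ F with hGdef
  have hG : ∀ k, k ∈ G ↔ k < n ∧ cycleStep a k ∈ F := fun k => by
    rw [hGdef, mem_filter, mem_range]
  have hstart : IsRunStart m F a ↔ Ico 0 m ⊆ G ∧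
      G ⊆ Ico m (m + L) ∪ (Ico 0 m ∪ Ico (m + L) (n - 1)) := by
    refine and_congr ⟨fun h k hk => ?_, fun h k hk => ?_⟩ ⟨fun h k hk => ?_, fun h h' => ?_⟩
    · rw [mem_Ico] at hk
      exact (hG k).2 ⟨by omega, h k hk.2⟩
    · exact ((hG k).1 (h (mem_Ico.2 ⟨by omega, hk⟩))).2
    · obtain ⟨h1, h2⟩ := (hG k).1 hk
      have : k ≠ n - 1 := by rintro rfl; exact h h2
      simp only [mem_union, mem_Ico]
      omega
    · have := h ((hG (n - 1)).2 ⟨by omega, h'⟩)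
      simp only [mem_union, mem_Ico] at this
      omega
  rw [← hstart, IsLastRunStart, and_comm]
  refine and_congr_left fun hs => ?_
  have hs' := hstart.1 hs
  constructor
  · refine fun h => ⟨inter_subset_right, fun j h1 h2 h3 => ?_⟩
    by_contra hj
    have hj' : j - 1 ∉ G := fun h4 => hj (mem_inter.2 ⟨h4, mem_Ico.2 ⟨by omega, by omega⟩⟩)
    have hstep : (⟨a.val + j, by omega⟩ : Fin n) = cycleStep a j :=
      Fin.ext (Nat.mod_eq_of_lt (by omega)).symm
    refine h ⟨a.val + j, by omega⟩ (Fin.lt_def.2 (by simp only; omega)) ⟨fun k hk => ?_, ?_⟩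
    · rw [hstep, cycleStep_cycleStep]
      exact ((hG _).1 (mem_inter.1 (h3 (mem_Ico.2 ⟨by omega, by omega⟩))).1).2
    · rw [hstep, cycleStep_cycleStep, show j + (n - 1) = j - 1 + n by omega, cycleStep_add_self]
      exact fun h4 => hj' ((hG _).2 ⟨by omega, h4⟩)
  · rintro ⟨-, h⟩ a' haa' ⟨h1, h2⟩
    rw [Fin.lt_def] at haa'
    have ha' := a'.2
    obtain ⟨k, hk⟩ := Nat.exists_eq_add_of_le haa'.le
    have hstep : a' = cycleStep a k := Fin.ext (by
      rw [hk]; exact (Nat.mod_eq_of_lt (by omega)).symm)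
    rw [hstep] at h1 h2
    simp only [cycleStep_cycleStep] at h1 h2
    rw [show k + (n - 1) = k - 1 + n by omega, cycleStep_add_self] at h2
    -- The predecessor of a new run start is absent, so it lies outside the initial m positions.
    have hkm : m ≤ k - 1 := by
      by_contra hlt
      exact h2 ((hG _).1 (hs'.1 (mem_Ico.2 ⟨by omega, by omega⟩))).2
    by_cases hkn : k + m ≤ n - 1
    · refine h2 ((hG _).1 (mem_inter.1 (h k (by omega) (by omega) fun x hx => ?_)).1).2
      rw [mem_Ico] at hx
      refine mem_inter.2 ⟨(hG x).2 ⟨by omega, ?_⟩, mem_Ico.2 ⟨by omega, by omega⟩⟩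
      have := h1 (x - k) (by omega)
      rwa [show k + (x - k) = x by omega] at this
    · refine hs.2 ?_
      have := h1 (n - 1 - k) (by omega)
      rwa [show k + (n - 1 - k) = n - 1 by omega] at this

/-- The path behind the first m vertices has L ≤ n−m−1 vertices and costs at most p(n−m−1); the
absent predecessor of a accounts for the additional 1. -/
lemma hasIntervalPartition_isLastRunStart (hm : 1 ≤ m) (hmn : m < n) (a : Fin n) :
    HasIntervalPartition univ (fun F => IsLastRunStart m F a) (pathCodim m (n - (m + 1)) + 1) := by
  have ha := a.2
  obtain ⟨L, hL⟩ : ∃ L, L = min (n - 1 - a.val) (n - 1 - m) := ⟨_, rfl⟩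
  have h1 := (hasIntervalPartition_initialRunSets hm L m).extend
    (V' := Ico 0 m ∪ Ico (m + L) n) (A := Ico 0 m) (B := Ico 0 m ∪ Ico (m + L) (n - 1))
    (κ' := pathCodim m (n - (m + 1)) + 1)
    (disjoint_left.2 fun x hx hx' => by simp at hx hx'; omega) subset_union_left
    (union_subset_union subset_rfl (Ico_subset_Ico_right (by omega))) (by
      have h2 := pathCodim_mono (m := m) (show L ≤ n - (m + 1) by omega)
      rw [card_union_of_disjoint (disjoint_left.2 fun x hx hx' => by simp at hx hx'; omega),
        card_union_of_disjoint (disjoint_left.2 fun x hx hx' => by simp at hx hx'; omega)]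
      simp only [Nat.card_Ico]
      omega)
  have e : Ico m (m + L) ∪ (Ico 0 m ∪ Ico (m + L) n) = range n := by ext x; simp; omega
  rw [e] at h1
  have h2 := h1.image (injOn_cycleStep a)
  rw [image_cycleStep] at h2
  refine h2.congr fun F => ?_
  rw [isLastRunStart_iff hmn a hL]
  exact ⟨fun h => ⟨subset_univ _, h⟩, fun h => h.2⟩

/-- The whole vertex set has no run start and forms an interval by itself; every other set with a
window has a unique last run start. -/
lemma hasIntervalPartition_cycle (hm : 1 ≤ m) (hmn : m < n) :
    HasIntervalPartition univ (fun F : Finset (Fin n) => ∃ a, ∀ k < m, cycleStep a k ∈ F)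
      (pathCodim m (n - (m + 1)) + 1) := by
  have h1 := HasIntervalPartition.exists_mem (univ : Finset (Fin n))
    (fun a _ => hasIntervalPartition_isLastRunStart hm hmn a) fun a a' F h h' => h.eq h'
  have h2 := HasIntervalPartition.interval (κ := pathCodim m (n - (m + 1)) + 1)
    (subset_refl (univ : Finset (Fin n))) (subset_refl _) (Nat.le_add_right _ _)
  refine (h1.or h2 ?_).congr fun F => ?_
  · rintro F ⟨a, -, h3⟩ ⟨h4, -⟩
    exact h3.1.2 (h4 (mem_univ _))
  · constructor
    · rintro ⟨a, ha⟩
      by_cases hF : F = univ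
      · subst hF; exact Or.inr ⟨subset_rfl, subset_rfl⟩
      · obtain ⟨b, hb⟩ := exists_isRunStart hF ha
        obtain ⟨c, hc⟩ := exists_isLastRunStart hb
        exact Or.inl ⟨c, mem_univ c, hc⟩
    · rintro (⟨a, -, ha⟩ | ⟨h, -⟩)
      · exact ⟨a, ha.1.1⟩
      · exact ⟨⟨0, by omega⟩, fun k _ => h (mem_univ _)⟩

end CyclePartition

/-! ### From set families to Stanley decompositions -/

section StanleyDepth

variable {K σ : Type*} [Field K]

lemma StanleyDecomposition.sdepth_le_card {M : Type*} [AddCommGroup M] [Module K M]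
    [Module (MvPolynomial σ K) M] [IsScalarTower K (MvPolynomial σ K) M]
    {𝓜 : (σ → ℤ) → Submodule K M} (D : StanleyDecomposition 𝓜) (i : Fin D.r) :
    D.sdepth ≤ (D.Z i).card :=
  ciInf_le (OrderBot.bddBelow _) i

lemma StanleyDecomposition.sdepth_le_stanleyDepth [Fintype σ] {M : Type*} [AddCommGroup M]
    [Module K M] [Module (MvPolynomial σ K) M] [IsScalarTower K (MvPolynomial σ K) M]
    {𝓜 : (σ → ℤ) → Submodule K M} (D : StanleyDecomposition 𝓜) :
    D.sdepth ≤ stanleyDepth 𝓜 := by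
  -- The number of variables bounds the supremum; a decomposition without summands has infimum 0 by
  -- convention.
  refine le_csSup ⟨Fintype.card σ, ?_⟩ ⟨D, rfl⟩
  rintro _ ⟨D', rfl⟩
  by_cases h : Nonempty (Fin D'.r)
  · exact (D'.sdepth_le_card h.some).trans (Finset.card_le_univ _)
  · rw [not_nonempty_iff] at h
    simp [StanleyDecomposition.sdepth]

lemma support_subset_of_mem_supported {Z : Set σ} {p : MvPolynomial σ K} (hp : p ∈ supported K Z)
    {u : σ →₀ ℕ} (hu : coeff u p ≠ 0) : (u.support : Set σ) ⊆ Z := fun j hj =>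
  mem_supported.1 hp (Finset.mem_coe.2 ((mem_vars_iff_mem_support j).2 ⟨u, mem_support_iff.2 hu, hj⟩))

lemma monomial_mem_supported {Z : Finset σ} {u : σ →₀ ℕ} (hu : u.support ⊆ Z) (c : K) :
    monomial u c ∈ supported K (Z : Set σ) := by
  by_cases hc : c = 0
  · rw [hc, monomial_zero]; exact Subalgebra.zero_mem _
  · rw [mem_supported, vars_monomial hc]
    exact Finset.coe_subset.2 hu

variable [DecidableEq σ]

/-- Turns disjointness and covering for intervals into independence and spanning for the Stanley
spaces, which are thus seen to be spanned by monomials. -/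
lemma mem_stanleySpace_sqfreeIdeal {U : Finset σ → Prop} {A B : Finset σ} (hAB : A ⊆ B)
    (hA : monomial (sqfreeExp A) (1 : K) ∈ sqfreeIdeal K U) (x : sqfreeIdeal K U) :
    x ∈ stanleySpace K (⟨_, hA⟩ : sqfreeIdeal K U) B ↔
      ∀ u, coeff u x.val ≠ 0 → A ⊆ u.support ∧ u.support ⊆ B := by
  rw [stanleySpace, Submodule.mem_map]
  constructor
  · rintro ⟨p, hp, rfl⟩ u hu
    have hp' : p ∈ supported K (B : Set σ) := hp
    replace hu : coeff u (p * monomial (sqfreeExp A) 1) ≠ 0 := hu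
    rw [coeff_mul_monomial'] at hu
    split_ifs at hu with h
    · rw [mul_one] at hu
      refine ⟨sqfreeExp_le.1 h, ?_⟩
      have h1 := support_add_eq_union (u - sqfreeExp A) (sqfreeExp A)
      rw [tsub_add_cancel_of_le h, support_sqfreeExp] at h1
      rw [h1]
      exact Finset.union_subset (Finset.coe_subset.1 (support_subset_of_mem_supported hp' hu)) hAB
    · exact absurd rfl hu
  · intro h
    refine ⟨∑ u ∈ x.val.support, monomial (u - sqfreeExp A) (coeff u x.val), ?_, ?_⟩
    · refine Subalgebra.sum_mem _ fun u hu => monomial_mem_supported ?_ _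
      refine (Finsupp.support_mono tsub_le_self).trans (h u (mem_support_iff.1 hu)).2
    · apply Subtype.ext
      change (∑ u ∈ x.val.support, monomial (u - sqfreeExp A) (coeff u x.val)) *
        monomial (sqfreeExp A) 1 = x.val
      conv_rhs => rw [x.val.as_sum]
      rw [Finset.sum_mul]
      refine Finset.sum_congr rfl fun u hu => ?_
      rw [monomial_mul, mul_one,
        tsub_add_cancel_of_le (sqfreeExp_le.2 (h u (mem_support_iff.1 hu)).1)]

/-- An interval partition of the family `U` gives a Stanley decomposition of the squarefree
monomial ideal defined by `U`. -/
lemma HasIntervalPartition.le_stanleyDepth [Fintype σ] {U : Finset σ → Prop} (hU : IsUpClosed U)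
    (hne : U Finset.univ) {κ : ℕ} (h : HasIntervalPartition Finset.univ U κ) :
    Fintype.card σ ≤ stanleyDepth (idealGrading (sqfreeIdeal K U)) + κ := by
  obtain ⟨C, h1, h2, h3⟩ := h
  let e := C.equivFin
  let lo : Fin C.card → Finset σ := fun i => (e.symm i).val.1
  let hi : Fin C.card → Finset σ := fun i => (e.symm i).val.2
  have hle : ∀ i, lo i ⊆ hi i := fun i => (h1 _ (e.symm i).2).1
  have hlo : ∀ i, monomial (sqfreeExp (lo i)) (1 : K) ∈ sqfreeIdeal K U := fun i =>
    monomial_mem_sqfreeIdeal (by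
      rw [support_sqfreeExp]
      exact (h2 _).2 ⟨_, (e.symm i).2, subset_rfl, hle i⟩)
  have huniq : ∀ i j (F : Finset σ), lo i ⊆ F → F ⊆ hi i → lo j ⊆ F → F ⊆ hi j → i = j := by
    intro i j F a b a' b'
    have := h3 F _ (e.symm i).2 _ (e.symm j).2 a b a' b'
    exact e.symm.injective (Subtype.ext this)
  have hcov : ∀ F, U F → ∃ i, lo i ⊆ F ∧ F ⊆ hi i := by
    intro F hF
    obtain ⟨c, hc, h4⟩ := (h2 F).1 hF
    refine ⟨e ⟨c, hc⟩, ?_⟩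
    simp only [lo, hi, Equiv.symm_apply_apply]
    exact h4
  let D : StanleyDecomposition (idealGrading (sqfreeIdeal K U)) :=
    { r := C.card
      w := fun i => ⟨_, hlo i⟩
      Z := hi
      homogeneous := fun i => ⟨_, isWeightedHomogeneous_monomial _ _ _ rfl⟩
      free := by
        intro i u _ hu
        have h4 : u * monomial (sqfreeExp (lo i)) 1 = 0 := congrArg Subtype.val hu
        refine (mul_eq_zero.1 h4).resolve_right ?_
        rw [monomial_eq_zero]
        exact one_ne_zero
      isInternal := by
        have hmem := fun i x => mem_stanleySpace_sqfreeIdeal (K := K) (U := U) (hle i) (hlo i) x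
        refine DirectSum.isInternal_submodule_of_iSupIndep_of_iSup_eq_top ?_ ?_
        · rw [iSupIndep_def]
          intro i
          -- Elements without monomials from interval i; by disjointness it contains all the other
          -- Stanley spaces, and it meets the i-th one in zero.
          let B : Submodule K (sqfreeIdeal K U) :=
            { carrier := {x | ∀ u : σ →₀ ℕ, lo i ⊆ u.support → u.support ⊆ hi i →
                coeff u x.val = 0}
              zero_mem' := fun u _ _ => coeff_zero u
              add_mem' := fun {x y} hx hy u a b => by
                rw [Submodule.coe_add, coeff_add, hx u a b, hy u a b, add_zero]
              smul_mem' := fun c x hx u a b => by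
                have := hx u a b
                change coeff u (c • x.val) = 0
                rw [coeff_smul, this, smul_zero] }
          have hB : (⨆ j, ⨆ (_ : j ≠ i), stanleySpace K (⟨_, hlo j⟩ : sqfreeIdeal K U) (hi j)) ≤
              B := by
            refine iSup₂_le fun j hj x hx u a b => ?_
            by_contra hne
            have h4 := (hmem j x).1 hx u hne
            exact hj (huniq j i _ h4.1 h4.2 a b)
          rw [Submodule.disjoint_def]
          intro x hx hx'
          apply Subtype.ext
          ext u
          by_contra hne
          have h4 := (hmem i x).1 hx u hne
          exact hne (hB hx' u h4.1 h4.2)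
        · rw [eq_top_iff]
          intro x _
          have hx := (mem_sqfreeIdeal hU).1 x.2
          have hm : ∀ u ∈ x.val.support, monomial u (coeff u x.val) ∈ sqfreeIdeal K U := by
            intro u hu
            rw [mem_sqfreeIdeal hU]
            intro v hv
            rw [coeff_monomial] at hv
            split_ifs at hv with huv
            · exact huv ▸ hx u (mem_support_iff.1 hu)
            · exact absurd rfl hv
          have hsum : x = ∑ u ∈ x.val.support.attach,
              (⟨monomial u.val (coeff u.val x.val), hm u.val u.2⟩ : sqfreeIdeal K U) := by
            apply Subtype.ext
            rw [AddSubmonoidClass.coe_finsetSum]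
            conv_lhs => rw [x.val.as_sum]
            exact (Finset.sum_attach x.val.support
              (fun u => monomial u (coeff u x.val))).symm
          rw [hsum]
          refine Submodule.sum_mem _ fun u _ => ?_
          obtain ⟨i, hi1⟩ := hcov _ (hx u.val (mem_support_iff.1 u.2))
          refine Submodule.mem_iSup_of_mem i ((hmem i _).2 fun v hv => ?_)
          rw [coeff_monomial] at hv
          split_ifs at hv with huv
          · exact huv ▸ hi1
          · exact absurd rfl hv }
  have hD : Fintype.card σ ≤ D.sdepth + κ := by
    obtain ⟨i, -⟩ := hcov _ hne
    have : Nonempty (Fin D.r) := ⟨i⟩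
    rw [← Nat.sub_le_iff_le_add]
    refine le_ciInf fun j => ?_
    have := (h1 _ (e.symm j).2).2.2
    rw [Finset.card_univ] at this
    exact Nat.sub_le_iff_le_add.2 this
  exact hD.trans (Nat.add_le_add_right D.sdepth_le_stanleyDepth κ)

lemma weight_piSingle_apply (u : σ →₀ ℕ) (j : σ) :
    Finsupp.weight (fun i : σ => (Pi.single i 1 : σ → ℤ)) u j = u j := by
  rw [Finsupp.weight_apply, Finsupp.sum, Finset.sum_apply]
  simp only [nsmul_eq_mul, Pi.mul_apply, Pi.single_apply, Pi.natCast_apply, mul_ite, mul_one,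
    mul_zero, Finset.sum_ite_eq, Finsupp.mem_support_iff, ne_eq, ite_not, ite_eq_right_iff]
  intro h
  rw [h, Nat.cast_zero]

lemma exists_eq_monomial_of_mem_multiDegree {a : σ → ℤ} {p : MvPolynomial σ K}
    (hp : p ∈ multiDegree K a) : ∃ s c, p = monomial s c := by
  by_cases h0 : p = 0
  · exact ⟨0, 0, by rw [h0, monomial_zero]⟩
  obtain ⟨s, hs⟩ := ne_zero_iff.1 h0
  refine ⟨s, coeff s p, ?_⟩
  ext u
  rw [coeff_monomial]
  split_ifs with h
  · rw [h]
  · by_contra hu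
    refine h (Finsupp.ext fun j => ?_)
    have h1 := congrFun (hp hs) j
    have h2 := congrFun (hp hu) j
    rw [weight_piSingle_apply] at h1 h2
    exact_mod_cast h1.trans h2.symm

/-- The Stanley depth of `S / I_U` is at most the cardinality of any maximal set without the
property `U`. -/
lemma stanleyDepth_quotient_le {U : Finset σ → Prop} (hU : IsUpClosed U) {G : Finset σ}
    (hG : ¬ U G) (hmax : ∀ T, G ⊆ T → ¬ U T → T = G) :
    stanleyDepth (quotientGrading (sqfreeIdeal K U)) ≤ G.card := by
  refine csSup_le' ?_
  rintro _ ⟨D, rfl⟩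
  have hmon : ∀ i, ∃ s c, D.w i = Submodule.Quotient.mk (monomial s c) := by
    intro i
    obtain ⟨a, p, hp, hpw⟩ := D.homogeneous i
    obtain ⟨s, c, rfl⟩ := exists_eq_monomial_of_mem_multiDegree hp
    exact ⟨s, c, hpw.symm⟩
  choose s c hw using hmon
  -- The exponent N exceeds those of all generators, so a summand reaching x^g must have every
  -- variable of G among its free ones.
  obtain ⟨N, hN⟩ : ∃ N : ℕ, ∀ i j, s i j < N := by
    refine ⟨∑ i, ∑ j ∈ (s i).support, s i j + 1, fun i j => Nat.lt_succ_of_le ?_⟩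
    by_cases hj : j ∈ (s i).support
    · exact (Finset.single_le_sum (f := fun j => s i j) (fun _ _ => Nat.zero_le _) hj).trans
        (Finset.single_le_sum (f := fun i => ∑ j ∈ (s i).support, s i j)
          (fun _ _ => Nat.zero_le _) (Finset.mem_univ i))
    · rw [Finsupp.notMem_support_iff.1 hj]; exact Nat.zero_le _
  obtain ⟨g, hgG, hg0⟩ : ∃ g : σ →₀ ℕ, (∀ j ∈ G, g j = N) ∧ ∀ j ∉ G, g j = 0 := by
    refine ⟨N • sqfreeExp G, fun j hj => ?_, fun j hj => ?_⟩ <;>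
      simp [sqfreeExp_apply, hj]
  have hgs : g.support ⊆ G := by
    intro j hj
    by_contra h
    exact Finsupp.mem_support_iff.1 hj (hg0 j h)
  have hJ : ∀ p ∈ sqfreeIdeal K U, coeff g p = 0 := by
    intro p hp
    by_contra h
    exact hG (hU hgs ((mem_sqfreeIdeal hU).1 hp g h))
  -- Vanishing of the coefficient of x^g is well defined on the quotient because x^g is not in the
  -- ideal. Some summand must escape this proper subspace.
  let B : Submodule K (MvPolynomial σ K ⧸ sqfreeIdeal K U) :=
    { carrier := {y | ∀ p, Submodule.Quotient.mk p = y → coeff g p = 0}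
      zero_mem' := fun p hp => hJ p ((Submodule.Quotient.mk_eq_zero _).1 hp)
      add_mem' := fun {y z} hy hz p hp => by
        obtain ⟨a, rfl⟩ := Submodule.Quotient.mk_surjective _ y
        have h1 := hy a rfl
        have h2 := hz (p - a) (by rw [Submodule.Quotient.mk_sub, hp, add_sub_cancel_left])
        rw [coeff_sub, h1, sub_zero] at h2
        exact h2
      smul_mem' := fun k y hy p hp => by
        obtain ⟨a, rfl⟩ := Submodule.Quotient.mk_surjective _ y
        have h1 := hy a rfl
        have h2 := hJ (p - k • a) ((Submodule.Quotient.mk_eq_zero _).1 (by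
          rw [Submodule.Quotient.mk_sub, hp]; exact sub_self _))
        rw [coeff_sub, coeff_smul, h1, smul_zero, sub_zero] at h2
        exact h2 }
  obtain ⟨i, hi⟩ : ∃ i, ¬ stanleySpace K (D.w i) (D.Z i) ≤ B := by
    by_contra! h
    have htop : (⊤ : Submodule K (MvPolynomial σ K ⧸ sqfreeIdeal K U)) ≤ B := by
      rw [← D.isInternal.submodule_iSup_eq_top]
      exact iSup_le h
    have := htop (x := Submodule.Quotient.mk (monomial g 1)) trivial _ rfl
    rw [coeff_monomial, if_pos rfl] at this
    exact one_ne_zero this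
  refine (D.sdepth_le_card i).trans (Finset.card_le_card ?_)
  obtain ⟨q, hq, hqg⟩ : ∃ q ∈ supported K (D.Z i : Set σ),
      coeff g (q * monomial (s i) (c i)) ≠ 0 := by
    by_contra! h
    refine hi ?_
    rintro _ ⟨q, hq, rfl⟩ p hp
    have h1 : (Submodule.Quotient.mk p : MvPolynomial σ K ⧸ sqfreeIdeal K U) =
        Submodule.Quotient.mk (q * monomial (s i) (c i)) := by
      rw [hp]
      change q • D.w i = _
      rw [hw i]; rfl
    rw [Submodule.Quotient.eq] at h1
    have h2 := hJ _ h1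
    rwa [coeff_sub, h q hq, sub_zero] at h2
  rw [coeff_mul_monomial'] at hqg
  split_ifs at hqg with hsg
  swap
  · exact absurd rfl hqg
  have hGZ : G ⊆ D.Z i := by
    intro j hj
    refine support_subset_of_mem_supported hq (left_ne_zero_of_mul hqg) ?_
    rw [Finset.mem_coe, Finsupp.mem_support_iff, Finsupp.tsub_apply, hgG j hj]
    have := hN i j
    omega
  -- Otherwise the product of the variables in Z would annihilate the generator, against freeness.
  -- Maximality of G then forces Z ⊆ G.
  have hfree : ¬ U (D.Z i ∪ (s i).support) := by
    intro hUZ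
    have h1 := D.free i (monomial (sqfreeExp (D.Z i)) 1)
      (monomial_mem_supported (by rw [support_sqfreeExp]) 1) (by
        rw [hw i, ← Submodule.Quotient.mk_smul, Submodule.Quotient.mk_eq_zero, smul_eq_mul,
          monomial_mul, mem_sqfreeIdeal hU]
        intro u hu
        rw [coeff_monomial] at hu
        split_ifs at hu with h
        · rwa [← h, support_add_eq_union, support_sqfreeExp]
        · exact absurd rfl hu)
    rw [monomial_eq_zero] at h1
    exact one_ne_zero h1
  have := hmax _ (hGZ.trans Finset.subset_union_left) hfree
  exact Finset.subset_union_left.trans this.le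

end StanleyDepth

/-! ### The path ideal and a small facet -/

section CyclePathIdeal

variable {K : Type*} [Field K] {n m : ℕ}

lemma cyclePathIdeal_eq_sqfreeIdeal (hmn : m < n) :
    cyclePathIdeal K n m =
      sqfreeIdeal K fun F : Finset (Fin n) => ∃ a, ∀ k < m, cycleStep a k ∈ F := by
  have hgen : ∀ a : Fin n, ∏ k ∈ Finset.range m, (X (cycleStep a k) : MvPolynomial (Fin n) K) =
      monomial (sqfreeExp ((Finset.range m).image (cycleStep a))) 1 := by
    intro a
    rw [monomial_sqfreeExp, Finset.prod_image]
    exact (injOn_cycleStep a).mono (Finset.coe_subset.2 (Finset.range_mono hmn.le))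
  rw [cyclePathIdeal]
  apply le_antisymm
  · rw [Ideal.span_le]
    rintro _ ⟨a, rfl⟩
    simp only [hgen]
    refine monomial_mem_sqfreeIdeal ⟨a, fun k hk => ?_⟩
    rw [support_sqfreeExp]
    exact Finset.mem_image_of_mem _ (Finset.mem_range.2 hk)
  · rw [sqfreeIdeal, Ideal.span_le]
    rintro _ ⟨s, ⟨a, ha⟩, rfl⟩
    refine Ideal.mem_of_dvd _ ?_ (Ideal.subset_span ⟨a, hgen a⟩)
    refine monomial_dvd_monomial.2 ⟨Or.inr (sqfreeExp_le.2 ?_), dvd_rfl⟩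
    intro v hv
    obtain ⟨k, hk, rfl⟩ := Finset.mem_image.1 hv
    exact ha k (Finset.mem_range.1 hk)

lemma cycleGens_iff (hmn : m < n) (F : Finset (Fin n)) :
    CycleGens m n F ↔ ∃ a, ∀ k < m, cycleStep a k ∈ F := by
  constructor
  · rintro ⟨j, hj, h1, h2⟩
    refine ⟨⟨j, hj⟩, fun k hk => ?_⟩
    by_cases h : j + k < n
    · have e : (cycleStep ⟨j, hj⟩ k : Fin n).val = j + k := Nat.mod_eq_of_lt h
      exact h1 _ (by omega) (by omega)
    · have e : (cycleStep ⟨j, hj⟩ k : Fin n).val = j + k - n := by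
        change (j + k) % n = _
        rw [Nat.mod_eq_sub_mod (by omega), Nat.mod_eq_of_lt (by omega)]
      exact h2 _ (by omega) (by omega)
  · rintro ⟨a, ha⟩
    have han := a.2
    refine ⟨a, a.2, fun v h1 h2 => ?_, fun v h1 h2 => ?_⟩
    · have e : cycleStep a (v.val - a) = v := Fin.ext (by
        change (a.val + (v.val - a)) % n = _
        rw [Nat.add_sub_of_le h1, Nat.mod_eq_of_lt v.2])
      exact e ▸ ha _ (by omega)
    · have e : cycleStep a (v.val + n - a) = v := Fin.ext (by
        change (a.val + (v.val + n - a)) % n = _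
        rw [Nat.add_sub_of_le (by omega), Nat.add_mod_right, Nat.mod_eq_of_lt v.2])
      exact e ▸ ha _ (by omega)

/-- The vertices of a minimal cover of the windows of length `m` in the `n`-cycle. -/
def IsCoverVertex (m n v : ℕ) : Prop := v % (m + 1) = m ∨ v % (m + 1) = 0 ∧ v + m ≤ n

/-- There are at least ⌊n/(m+1)⌋ cover vertices congruent to m and at least ⌊(n+1)/(m+1)⌋ congruent
to 0. -/
lemma pathCodim_le_card_cover [DecidablePred (IsCoverVertex m n)] (hm : 1 ≤ m) :
    pathCodim m n ≤ ((Finset.range n).filter (IsCoverVertex m n)).card := by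
  have hA : Function.Injective fun q => (m + 1) * q + m := fun a b h =>
    Nat.eq_of_mul_eq_mul_left m.succ_pos (Nat.add_right_cancel h)
  have hB : Function.Injective fun q => (m + 1) * q := fun a b h =>
    Nat.eq_of_mul_eq_mul_left m.succ_pos h
  have hmodA : ∀ q, ((m + 1) * q + m) % (m + 1) = m := fun q => by
    rw [Nat.mul_add_mod, Nat.mod_eq_of_lt (by omega)]
  have hmodB : ∀ q, ((m + 1) * q) % (m + 1) = 0 := fun q => Nat.mul_mod_right _ _
  have hcard : ((Finset.range (n / (m + 1))).image fun q => (m + 1) * q + m).card +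
      ((Finset.range ((n + 1) / (m + 1))).image fun q => (m + 1) * q).card = pathCodim m n := by
    rw [Finset.card_image_of_injective _ hA, Finset.card_image_of_injective _ hB,
      Finset.card_range, Finset.card_range, pathCodim]
  rw [← hcard, ← Finset.card_union_of_disjoint]
  · refine Finset.card_le_card fun v hv => ?_
    rw [Finset.mem_filter, Finset.mem_range]
    rcases Finset.mem_union.1 hv with hv | hv <;> obtain ⟨q, hq, rfl⟩ := Finset.mem_image.1 hv <;>
      rw [Finset.mem_range] at hq
    · have h1 : (m + 1) * (q + 1) ≤ n := (Nat.mul_le_mul_left _ hq).trans (Nat.mul_div_le _ _)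
      rw [mul_add] at h1
      exact ⟨by omega, Or.inl (hmodA q)⟩
    · have h1 : (m + 1) * (q + 1) ≤ n + 1 :=
        (Nat.mul_le_mul_left _ hq).trans (Nat.mul_div_le _ _)
      rw [mul_add] at h1
      exact ⟨by omega, Or.inr ⟨hmodB q, by omega⟩⟩
  · rw [Finset.disjoint_left]
    intro v h1 h2
    obtain ⟨q, -, rfl⟩ := Finset.mem_image.1 h1
    obtain ⟨q', -, h⟩ := Finset.mem_image.1 h2
    have h3 := hmodA q
    have h4 := hmodB q'
    rw [h] at h4
    omega

lemma not_isCoverVertex {q t v : ℕ} (h1 : 1 ≤ t) (h2 : t < m) (hv : v = (m + 1) * q + t) :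
    ¬ IsCoverVertex m n v := by
  have : v % (m + 1) = t := by rw [hv, Nat.mul_add_mod, Nat.mod_eq_of_lt (by omega)]
  rintro (h | ⟨h, -⟩) <;> omega

/-- The facet is the complement of the cover. Wrapping windows contain 0, and any other window meets
the residue m or starts at residue 0. It is maximal because each cover vertex c has a window
containing no other one: the window ending at c for residue m, the one starting at c for residue 0.
-/
lemma exists_facet (hm : 1 ≤ m) (hmn : m < n) : ∃ G : Finset (Fin n),
    G.card + pathCodim m n ≤ n ∧ (¬ CycleGens m n G) ∧
    ∀ T, G ⊆ T → ¬ CycleGens m n T → T = G := by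
  classical
  let G : Finset (Fin n) := Finset.univ.filter fun v => ¬ IsCoverVertex m n v.val
  have hG : ∀ v, v ∈ G ↔ ¬ IsCoverVertex m n v.val := fun v => by simp [G]
  refine ⟨G, ?_, ?_, fun T hGT hT => ?_⟩
  · have h1 := pathCodim_le_card_cover (m := m) (n := n) hm
    have h2 := Finset.card_filter_add_card_filter_not (s := (Finset.univ : Finset (Fin n)))
      (fun v : Fin n => IsCoverVertex m n v.val)
    have h3 : ((Finset.univ : Finset (Fin n)).filter
        fun v : Fin n => IsCoverVertex m n v.val).card =
        ((Finset.range n).filter (IsCoverVertex m n)).card := by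
      rw [← Finset.card_map Fin.valEmbedding]
      congr 1
      ext v
      simp only [Finset.mem_map, Finset.mem_filter, Finset.mem_univ, true_and,
        Fin.valEmbedding_apply, Finset.mem_range]
      exact ⟨fun ⟨w, hw, h⟩ => h ▸ ⟨w.2, hw⟩, fun ⟨hv, hw⟩ => ⟨⟨v, hv⟩, hw, rfl⟩⟩
    rw [Finset.card_univ, Fintype.card_fin] at h2
    have h4 : G.card = ((Finset.univ : Finset (Fin n)).filter
        fun v : Fin n => ¬ IsCoverVertex m n v.val).card := rfl
    omega
  · rintro ⟨j, hj, h1, h2⟩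
    by_cases hjn : j + m ≤ n
    · have hdm := Nat.div_add_mod j (m + 1)
      have hlt : j % (m + 1) < m + 1 := Nat.mod_lt j m.succ_pos
      by_cases h0 : j % (m + 1) = 0
      · exact (hG _).1 (h1 ⟨j, hj⟩ le_rfl (by simp only; omega)) (Or.inr ⟨h0, hjn⟩)
      · refine (hG _).1 (h1 ⟨j + (m - j % (m + 1)), by omega⟩ (by simp only; omega)
          (by simp only; omega)) (Or.inl ?_)
        have e : j + (m - j % (m + 1)) = (m + 1) * (j / (m + 1)) + m := by omega
        simp only
        rw [e, Nat.mul_add_mod, Nat.mod_eq_of_lt (by omega)]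
    · exact (hG _).1 (h2 ⟨0, by omega⟩ le_rfl (by simp only; omega))
        (Or.inr ⟨Nat.zero_mod _, by simp only; omega⟩)
  · refine (hGT.antisymm fun c hc => ?_).symm
    rw [hG]
    intro hcov
    have hdm := Nat.div_add_mod c.val (m + 1)
    have hcn := c.2
    obtain ⟨j, hjn, hjm, hrun⟩ : ∃ j, j < n ∧ j + m ≤ n ∧ ∀ v : Fin n, j ≤ v.val →
        v.val < j + m → v ≠ c → ¬ IsCoverVertex m n v.val := by
      rcases hcov with h | ⟨h, h'⟩
      · refine ⟨c + 1 - m, by omega, by omega, fun v h1 h2 h3 => ?_⟩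
        have h4 : v.val ≠ c.val := fun h => h3 (Fin.ext h)
        exact not_isCoverVertex (q := c.val / (m + 1))
          (t := v.val - (m + 1) * (c.val / (m + 1))) (by omega) (by omega) (by omega)
      · refine ⟨c, hcn, h', fun v h1 h2 h3 => ?_⟩
        have h4 : v.val ≠ c.val := fun h => h3 (Fin.ext h)
        exact not_isCoverVertex (q := c.val / (m + 1))
          (t := v.val - (m + 1) * (c.val / (m + 1))) (by omega) (by omega) (by omega)
    refine hT ⟨j, hjn, fun v h1 h2 => ?_, fun v _ _ => by omega⟩
    by_cases hvc : v = c
    · exact hvc ▸ hc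
    · exact hGT ((hG v).2 (hrun v h1 h2 hvc))

end CyclePathIdeal

/-! ### Translation to φ and the main theorem -/

lemma pathPhi_eq (N : ℤ) (L m : ℕ) (hL : N + 1 = L) :
    pathPhi N m = L - cycleCodim m L := by
  have h0 : (0 : ℚ) < (m : ℚ) + 1 := by positivity
  have hN : ((N : ℚ) + 1) = L := by exact_mod_cast hL
  have hdm := Nat.div_add_mod L (m + 1)
  have hlt : L % (m + 1) < m + 1 := Nat.mod_lt L m.succ_pos
  have hdm' := Nat.div_add_mod (L + m) (m + 1)
  have hlt' : (L + m) % (m + 1) < m + 1 := Nat.mod_lt (L + m) m.succ_pos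
  have h1 : ⌊((N : ℚ) + 1) / (((m : ℤ) : ℚ) + 1)⌋ = ((L / (m + 1) : ℕ) : ℤ) := by
    rw [hN, Int.cast_natCast, Int.floor_eq_iff, le_div_iff₀ h0, div_lt_iff₀ h0]
    constructor
    · have : L / (m + 1) * (m + 1) ≤ L := Nat.div_mul_le_self _ _
      exact_mod_cast this
    · have : L < (L / (m + 1) + 1) * (m + 1) := by rw [add_mul, mul_comm]; omega
      exact_mod_cast this
  have h2 : ⌈((N : ℚ) + 1) / (((m : ℤ) : ℚ) + 1)⌉ = (((L + m) / (m + 1) : ℕ) : ℤ) := by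
    rw [hN, Int.cast_natCast, Int.ceil_eq_iff, lt_div_iff₀ h0, div_le_iff₀ h0]
    constructor
    · have h3 : (L + m) / (m + 1) * (m + 1) < L + (m + 1) := by rw [mul_comm]; omega
      have h4 : (((L + m) / (m + 1) : ℕ) : ℚ) * ((m : ℚ) + 1) < L + ((m : ℚ) + 1) := by
        exact_mod_cast h3
      rw [Int.cast_natCast, sub_mul, one_mul]
      linarith
    · have : L ≤ (L + m) / (m + 1) * (m + 1) := by rw [mul_comm]; omega
      exact_mod_cast this
  have h3 : pathPhi N m = N + 1 - ⌊((N : ℚ) + 1) / (((m : ℤ) : ℚ) + 1)⌋ -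
      ⌈((N : ℚ) + 1) / (((m : ℤ) : ℚ) + 1)⌉ := rfl
  rw [h3, h1, h2, hL, cycleCodim, Nat.cast_add]
  ring

theorem mainTheorem3 {K : Type*} [Field K] (n m : ℕ) (hm : 2 ≤ m) (hnm : m < n) :
    (min (pathPhi (n - 1) m + m - 1) (pathPhi n m + 1) ≤
      (stanleyDepth (idealGrading (cyclePathIdeal K n m)) : ℤ)) ∧
    (gradedDepth K (Fin n) (cyclePathIdeal K n m) ≤
        stanleyDepth (idealGrading (cyclePathIdeal K n m)) ∧
      (gradedDepth K (Fin n) (cyclePathIdeal K n m) : ℤ) = pathPhi (n - 1) m + 1) ∧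
    (3 ≤ m →
      pathPhi n m + 1 ≤ (stanleyDepth (idealGrading (cyclePathIdeal K n m)) : ℤ) ∧
      (stanleyDepth (quotientGrading (cyclePathIdeal K n m)) : ℤ) + 1 ≤ pathPhi n m + 1) := by
  have hm1 : 1 ≤ m := by omega
  have hU : (fun F : Finset (Fin n) => ∃ a, ∀ k < m, cycleStep a k ∈ F) =
      CycleGens m n := funext fun F => propext (cycleGens_iff hnm F).symm
  have hpart := hasIntervalPartition_cycle hm1 hnm
  rw [cyclePathIdeal_eq_sqfreeIdeal hnm, hU]
  rw [hU] at hpart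
  have hs := hpart.le_stanleyDepth (K := K) (isUpClosed_cycleGens m n) (cycleGens_univ hnm)
  rw [Fintype.card_fin] at hs
  have hd := gradedDepth_sqfreeIdeal_cycleGens (K := K) hm1 hnm
  obtain ⟨G, hG1, hG2, hG3⟩ := exists_facet hm1 hnm
  have hq := stanleyDepth_quotient_le (K := K) (isUpClosed_cycleGens m n) hG2 hG3
  have e1 := pathPhi_eq (n : ℤ) (n + 1) m (by push_cast; ring)
  have e2 := pathPhi_eq ((n : ℤ) - 1) n m (by ring)
  have e3 := cycleCodim_succ (m := m) n
  have e4 := pathCodim_add (m := m) (n - (m + 1))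
  rw [Nat.sub_add_cancel (by omega)] at e4
  have e5 := pathCodim_le_cycleCodim hm1 n
  push_cast at e1
  -- Since p(n) = p(n−m−1) + 2, the partition gives sdepth J ≥ n − p(n) + 1 = φ(n,m) + 1; this
  -- serves claims 1 and 3, and p(n) ≤ c(n) gives the comparison with depth.
  refine ⟨(min_le_right _ _).trans ?_, ⟨?_, ?_⟩, fun _ => ⟨?_, ?_⟩⟩ <;> omega
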